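/- Let $k$ be a field and let $P_1,\dots,P_n$ be distinct $k$-rational points of the projective space $\mathbf P^N_k$, and let $m\ge 2$ be an integer. For a rational point $P=(p_0:\dots:p_N)$ with first nonzero coordinate $p_i$, let $\mathrm{ev}_P$ be the linear form $f\mapsto f(p_0,\dots,p_N)/p_i^m$ on the space of homogeneous forms of degree $m$ in $N+1$ variables over $k$. A family of points is called $m$-linked if their evaluation maps $\mathrm{ev}_P$ are linearly dependent. Let $\mu$ be the smallest cardinality of a subset of $\{P_1,\dots,P_n\}$ that is $m$-linked, with $\mu=\infty$ if there is no such subset. Lines, planes and plane curves below are defined over $k$; a plane curve of degree $d$ is the zero locus, in some plane of $\mathbf P^N_k$, of a nonzero ternary form of degree $d$ (possibly reducible), a conic being one of degree $2$ and a cubic one of degree $3$. Two curves in the same plane have no common component if their equations have no nonconstant common factor. Then: (i) $\mu=m+2$ if and only if $m+2$ of the $P_i$ are collinear; (ii) $\mu=2m+2$ if and only if no $m+2$ of the $P_i$ are collinear and $2m+2$ of the $P_i$ lie on a plane conic; (iii) $m\ge 3$ and $\mu=3m$ if and only if no $m+2$ of the $P_i$ are collinear, no $2m+2$ of them lie on a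 plane conic, and $3m$ of them lie in the intersection of a plane cubic and a curve of degree $m$ in the same plane having no common component (in particular, for $m=2$, where $3m=2m+2$, the condition on the right never holds); (iv) $\mu>3m$ if and only if no $m+2$ of the $P_i$ are collinear, no $2m+2$ of them lie on a plane conic, and no $3m$ of them lie in the intersection of a plane cubic and a curve of degree $m$ in the same plane having no common component. -/

import Mathlib

open scoped LinearAlgebra.Projectivization

noncomputable section

/-- The index of the first nonzero homogeneous coordinate of a point of `ℙ^N`. -/
def leadIndex {k : Type*} [Field k] {N : ℕ} (P : ℙ k (Fin (N + 1) → k)) : Fin (N + 1) :=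
  letI := Classical.decEq k
  (Finset.univ.filter fun i => P.rep i ≠ 0).min' <| by
    obtain ⟨i, hi⟩ := Function.ne_iff.mp P.rep_nonzero
    exact ⟨i, by simpa using hi⟩

/-- The evaluation map `ev_P` on forms of degree `m` in `N + 1` variables:
`f ↦ f(p₀, …, p_N) / p_i ^ m`, where `p_i` is the first nonzero coordinate of `P`.
The value does not depend on the choice of the homogeneous coordinates `(p₀ : ⋯ : p_N)`. -/
def evForm {k : Type*} [Field k] {N : ℕ} (m : ℕ) (P : ℙ k (Fin (N + 1) → k)) :
    Module.Dual k (MvPolynomial.homogeneousSubmodule (Fin (N + 1)) k m) :=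
  ((P.rep (leadIndex P) ^ m)⁻¹ : k) •
    ((MvPolynomial.aeval P.rep).toLinearMap ∘ₗ
      (MvPolynomial.homogeneousSubmodule (Fin (N + 1)) k m).subtype)

/-- A family of rational points of `ℙ^N` is in `m`-general position if the corresponding
evaluation maps on forms of degree `m` are linearly independent. -/
def IsGeneralPosition {k : Type*} [Field k] {N : ℕ} {ι : Type*} (m : ℕ)
    (P : ι → ℙ k (Fin (N + 1) → k)) : Prop :=
  LinearIndependent k fun i => evForm m (P i)

/-- A family of points is `m`-linked if it is not in `m`-general position. -/
def IsLinked {k : Type*} [Field k] {N : ℕ} {ι : Type*} (m : ℕ)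
    (P : ι → ℙ k (Fin (N + 1) → k)) : Prop :=
  ¬ IsGeneralPosition m P

/-- The smallest number of `m`-linked points among `P₁, …, Pₙ`;
it is `⊤` if no subfamily is `m`-linked. -/
def minLinked {k : Type*} [Field k] {N n : ℕ} (m : ℕ)
    (P : Fin n → ℙ k (Fin (N + 1) → k)) : ℕ∞ :=
  ⨅ (S : Finset (Fin n)) (_ : IsLinked m fun i : S => P i), (S.card : ℕ∞)

/-- Some `d` of the points `P₁, …, Pₙ` lie on a projective line
(a line is given by a two-dimensional linear subspace of `k ^ (N + 1)`). -/
def HasCollinear {k : Type*} [Field k] {N n : ℕ} (d : ℕ)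
    (P : Fin n → ℙ k (Fin (N + 1) → k)) : Prop :=
  ∃ S : Finset (Fin n), S.card = d ∧
    ∃ L : Submodule k (Fin (N + 1) → k), Module.finrank k L = 2 ∧
      ∀ i ∈ S, (P i).submodule ≤ L

/-- `F` is the equation of a (possibly reducible) plane curve of degree `d`. -/
def IsCurveEquation {k : Type*} [Field k] (d : ℕ) (F : MvPolynomial (Fin 3) k) : Prop :=
  F ≠ 0 ∧ F.IsHomogeneous d

/-- Let `φ` be an injective linear map, i.e. a parametrized plane in `ℙ^N`, and let `F` be a
ternary form. The point `P` lies on the curve `F = 0` of this plane. -/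
def LiesOnCurve {k : Type*} [Field k] {N : ℕ} (φ : (Fin 3 → k) →ₗ[k] (Fin (N + 1) → k))
    (F : MvPolynomial (Fin 3) k) (P : ℙ k (Fin (N + 1) → k)) : Prop :=
  ∃ (v : Fin 3 → k) (hv : φ v ≠ 0),
    P = Projectivization.mk k (φ v) hv ∧ MvPolynomial.eval v F = 0

/-- Some `d` of the points `P₁, …, Pₙ` lie on a plane conic in `ℙ^N`. -/
def HasOnConic {k : Type*} [Field k] {N n : ℕ} (d : ℕ)
    (P : Fin n → ℙ k (Fin (N + 1) → k)) : Prop :=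
  ∃ S : Finset (Fin n), S.card = d ∧
    ∃ φ : (Fin 3 → k) →ₗ[k] (Fin (N + 1) → k), Function.Injective φ ∧
      ∃ F : MvPolynomial (Fin 3) k, IsCurveEquation 2 F ∧ ∀ i ∈ S, LiesOnCurve φ F (P i)

/-- Some `d` of the points `P₁, …, Pₙ` lie at the intersection of two coplanar plane curves in
`ℙ^N`, of degrees `a` and `b`, without common component (i.e. the equations have no common
factor; this is insensitive to extending the base field). -/
def HasOnIntersection {k : Type*} [Field k] {N n : ℕ} (d a b : ℕ)
    (P : Fin n → ℙ k (Fin (N + 1) → k)) : Prop :=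
  ∃ S : Finset (Fin n), S.card = d ∧
    ∃ φ : (Fin 3 → k) →ₗ[k] (Fin (N + 1) → k), Function.Injective φ ∧
      ∃ F G : MvPolynomial (Fin 3) k, IsCurveEquation a F ∧ IsCurveEquation b G ∧
        IsRelPrime F G ∧ ∀ i ∈ S, LiesOnCurve φ F (P i) ∧ LiesOnCurve φ G (P i)

end

/-!
Call `c` a relation of degree `m` if `∑ c i * f (v i) = 0` for all forms `f` of degree `m`, where
`v i` represents the point `P i`; a set of points is linked if it carries a nonzero relation. If
`g` is a form of degree `d ≤ m`, then `i ↦ c i * g (v i)` is a relation of degree `m - d` between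
the points outside the hypersurface `g = 0` (`IsRelation.mul`). Products of linear forms show that
a nonzero relation of degree `m` involves at least `m + 2` points.

That `m + 2` collinear points, `2 m + 2` points of a conic, or `3 m` points common to a cubic and
a curve of degree `m` are linked is a count of dimensions. For the converse, let `Γ` be the set of
points involved in a nonzero relation of degree `m`, and suppose that `#Γ ≤ 3 m`. Cutting by
hyperplanes, one sees that `m + 2` points of `Γ` are collinear or that `Γ` is coplanar
(`IsRelation.exists_line_or_plane`).

In the plane, let `h(j)` be the number of conditions imposed by `Γ` on forms of degree `j`. The
values on `Γ` of forms of degrees `j` and `m - j` are orthogonal for the nondegenerate form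
`∑ c i * x i * y i`, whence `h(j) + h(m - j) ≤ #Γ`
(`IsRelation.finrank_range_add_finrank_range_le`). Let `E` be a curve of minimal degree `e` through
`Γ`. The case `2 e > m + 3` is excluded by the inequality for `j` about `m / 2` (for small `m`, a
`j` up to `3`). Otherwise, if all curves through `Γ` of degree `m + 1 - e` contain `E`, then
`h(e - 1) + h(m + 1 - e)` equals `e (m + 3 - e)`, which is at most `3 m` only if `e ≤ 3`.

A curve `G` of degree `f` through `Γ` not containing `E` must have `e + f ≥ m + 3`: if `E` and `G`
are coprime, this compares the same inequality with Bézout's bound `#Γ ≤ e f`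
(`IsRelation.add_three_le_of_isRelPrime`), and a common factor `D` is removed by passing to the
relation of degree `m - deg D` outside `D` (`IsRelation.add_three_le_of_minimal`). Therefore
`e = 1`, or `e = 2` and `#Γ ≥ 2 m + 2`, or `e = 3` and `#Γ = 3 m`; in the last case there is a curve
of degree `m` through `Γ` not containing the cubic, and the same argument shows that it has no
common component with it (`IsRelation.plane_classification`). Everything is a count of dimensions
over `k`, so no extension of the base field is needed.
-/

noncomputable section

open MvPolynomial Module

/-! ### Relations between evaluations -/

section Relations

variable {k : Type*} [Field k] {σ τ ι : Type*}

/-- The linear map evaluating forms of degree `m` at the vectors `v i`. -/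
def evalMap (m : ℕ) (v : ι → σ → k) : homogeneousSubmodule σ k m →ₗ[k] (ι → k) :=
  LinearMap.pi fun i => (aeval (v i)).toLinearMap ∘ₗ (homogeneousSubmodule σ k m).subtype

@[simp]
lemma evalMap_apply (m : ℕ) (v : ι → σ → k) (f : homogeneousSubmodule σ k m) (i : ι) :
    evalMap m v f i = eval (v i) (f : MvPolynomial σ k) := by
  simp [evalMap, aeval_eq_eval]

/-- `c` is a linear relation between the evaluations at the vectors `v i` of the forms of
degree `m`. -/
def IsRelation [Fintype ι] (m : ℕ) (v : ι → σ → k) (c : ι → k) : Prop :=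
  ∀ f : MvPolynomial σ k, f.IsHomogeneous m → ∑ i, c i * eval (v i) f = 0

/-- The vectors `v i` represent pairwise distinct points of projective space. -/
def IsProjectivelyDistinct (v : ι → σ → k) : Prop :=
  (∀ i, v i ≠ 0) ∧ ∀ i j, i ≠ j → v i ∉ Submodule.span k {v j}

/-- The linear form given by a functional on the space of coordinates. -/
def linearForm [Fintype σ] [DecidableEq σ] (l : (σ → k) →ₗ[k] k) : MvPolynomial σ k :=
  ∑ s, C (l (Pi.single s 1)) * X s

lemma isHomogeneous_linearForm [Fintype σ] [DecidableEq σ] (l : (σ → k) →ₗ[k] k) :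
    (linearForm l).IsHomogeneous 1 :=
  IsHomogeneous.sum _ _ _ fun s _ => isHomogeneous_C_mul_X _ s

@[simp]
lemma eval_linearForm [Fintype σ] [DecidableEq σ] (l : (σ → k) →ₗ[k] k) (x : σ → k) :
    eval x (linearForm l) = l x := by
  conv_rhs => rw [LinearMap.pi_apply_eq_sum_univ l x]
  simp [linearForm, mul_comm, Pi.single]
  refine Finset.sum_congr rfl fun s _ => ?_
  congr 2
  ext t
  simp [Function.update_apply, eq_comm]

lemma exists_isHomogeneous_eval_comp [Fintype σ] [DecidableEq σ] {m : ℕ}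
    (ψ : (σ → k) →ₗ[k] (τ → k)) {f : MvPolynomial τ k} (hf : f.IsHomogeneous m) :
    ∃ g : MvPolynomial σ k, g.IsHomogeneous m ∧ ∀ x, eval x g = eval (ψ x) f := by
  set l : τ → MvPolynomial σ k := fun t => linearForm (LinearMap.proj t ∘ₗ ψ) with hl
  have he : ∀ t x, eval x (l t) = ψ x t := fun t x => by simp [hl]
  have hh : ∀ t, (l t).IsHomogeneous 1 := fun t => isHomogeneous_linearForm _
  clear_value l
  refine ⟨aeval l f, one_mul m ▸ hf.aeval l hh, fun x => ?_⟩
  clear hf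
  induction f using MvPolynomial.induction_on with
  | C a => simp
  | add p q hp hq => rw [map_add, map_add, map_add, hp, hq]
  | mul_X p t hp => rw [map_mul, map_mul, map_mul, hp, aeval_X, he, eval_X]

/-- Forms pull back along linear maps, so relations push forward. -/
lemma IsRelation.comp [Fintype ι] [Fintype σ] [DecidableEq σ] {m : ℕ} {v : ι → σ → k} {c : ι → k}
    (hc : IsRelation m v c) (ψ : (σ → k) →ₗ[k] (τ → k)) :
    IsRelation m (fun i => ψ (v i)) c := by
  intro f hf
  obtain ⟨g, hg, he⟩ := exists_isHomogeneous_eval_comp ψ hf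
  simpa [he] using hc g hg

/-- Multiplying the coefficients by the values of a form of degree `a` lowers the degree of a
relation by `a`, and removes the points at which the form vanishes. -/
lemma IsRelation.mul [Fintype ι] {a b : ℕ} {v : ι → σ → k} {c : ι → k}
    (hc : IsRelation (a + b) v c) {g : MvPolynomial σ k} (hg : g.IsHomogeneous a) :
    IsRelation b v (fun i => c i * eval (v i) g) := by
  intro f hf
  simpa [mul_assoc] using hc (g * f) (hg.mul hf)

/-- A nonzero relation of degree `m` between distinct points involves at least `m + 2` points. -/
lemma IsRelation.add_two_le_ncard_support [Fintype ι] [Fintype σ] [DecidableEq σ]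
    {v : ι → σ → k} (hv : IsProjectivelyDistinct v) {m : ℕ} {c : ι → k}
    (hc : IsRelation m v c) (h0 : c ≠ 0) : m + 2 ≤ (Function.support c).ncard := by
  induction m generalizing c with
  | zero =>
    obtain ⟨i, hi⟩ := Function.ne_iff.mp h0
    by_contra! hlt
    have h1 := hc 1 (isHomogeneous_one _ _)
    have hs : Function.support c = {i} := by
      symm
      apply Set.eq_of_subset_of_ncard_le (by simpa using hi)
      rw [Set.ncard_singleton]
      omega
    rw [Finset.sum_eq_single i] at h1
    · simp at h1; exact hi h1
    · intro j _ hj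
      have : j ∉ Function.support c := by rw [hs]; simpa using hj
      simp only [Function.mem_support, not_not] at this
      simp [this]
    · simp
  | succ m ih =>
    obtain ⟨i, hi⟩ := Function.ne_iff.mp h0
    -- a linear form separating `v i` from another point of the support, if there is one
    obtain ⟨l, hli, hl⟩ : ∃ l : (σ → k) →ₗ[k] k, l (v i) ≠ 0 ∧
        ∀ j, j ≠ i → c j ≠ 0 → ∃ j, c j ≠ 0 ∧ l (v j) = 0 := by
      by_cases h : ∃ j, j ≠ i ∧ c j ≠ 0
      · obtain ⟨j, hji, hj⟩ := h
        obtain ⟨l, h1, h2⟩ := Submodule.exists_le_ker_of_notMem (hv.2 i j hji.symm)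
        exact ⟨l, h1, fun _ _ _ => ⟨j, hj, h2 (Submodule.mem_span_singleton_self _)⟩⟩
      · push Not at h
        obtain ⟨l, h1, h2⟩ := Submodule.exists_le_ker_of_notMem
          (p := (⊥ : Submodule k (σ → k))) (v := v i) (by simpa using hv.1 i)
        exact ⟨l, h1, fun j hj hj' => absurd (h j hj) hj'⟩
    rw [add_comm m 1] at hc
    have hc' := hc.mul (isHomogeneous_linearForm l)
    simp only [eval_linearForm] at hc'
    have hi' : (fun i => c i * l (v i)) ≠ 0 := Function.ne_iff.mpr ⟨i, mul_ne_zero hi hli⟩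
    have h2 := ih hc' hi'
    have hsub : Function.support (fun i => c i * l (v i)) ⊆ Function.support c := by
      intro j hj; simp at hj ⊢; exact hj.1
    obtain ⟨j, hj, hji⟩ := Set.exists_ne_of_one_lt_ncard (lt_of_lt_of_le (by omega) h2) i
    obtain ⟨j', hj', hj0⟩ := hl j hji (hsub hj)
    have hss : Function.support (fun i => c i * l (v i)) ⊂ Function.support c := by
      refine ⟨hsub, fun h => ?_⟩
      have := h (show j' ∈ Function.support c from hj')
      simp [hj0] at this
    have := Set.ncard_lt_ncard hss (Set.toFinite _)
    omega

/-- The points fail to impose independent conditions on the forms of degree `m` exactly when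
there is a nonzero relation of degree `m`. -/
lemma finrank_range_evalMap_lt_iff [Fintype ι] {m : ℕ} {v : ι → σ → k} :
    finrank k (LinearMap.range (evalMap m v)) < Fintype.card ι ↔ ∃ c ≠ 0, IsRelation m v c := by
  classical
  rw [← Module.finrank_fintype_fun_eq_card (R := k) (η := ι)]
  constructor
  · intro h
    obtain ⟨l, hl, hle⟩ := Submodule.exists_le_ker_of_lt_top (LinearMap.range (evalMap m v))
      (lt_top_iff_ne_top.mpr fun h' => by rw [h', finrank_top] at h; exact h.false)
    refine ⟨fun i => l (Pi.single i 1), fun h0 => hl ?_, fun f hf => ?_⟩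
    · refine LinearMap.pi_ext' fun i => LinearMap.ext_ring ?_
      exact congrFun h0 i
    · have := hle ⟨⟨f, hf⟩, rfl⟩
      rw [LinearMap.mem_ker, LinearMap.pi_apply_eq_sum_univ l] at this
      simp only [evalMap_apply, smul_eq_mul] at this
      rw [← this]
      refine Finset.sum_congr rfl fun i _ => ?_
      have hs : (Pi.single i 1 : ι → k) = fun j => if i = j then 1 else 0 := by
        ext j
        simp [Pi.single_apply, eq_comm]
      rw [← hs, mul_comm]
  · rintro ⟨c, hc0, hc⟩
    apply Submodule.finrank_lt
    intro h
    obtain ⟨i, hi⟩ := Function.ne_iff.mp hc0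
    have : Pi.single i 1 ∈ LinearMap.range (evalMap m v) := h ▸ Submodule.mem_top
    obtain ⟨f, hf⟩ := this
    have h1 := hc f f.2
    have h2 : ∀ j, eval (v j) (f : MvPolynomial σ k) = (Pi.single i 1 : ι → k) j := fun j => by
      rw [← hf, evalMap_apply]
    simp [h2, Pi.single_apply] at h1
    exact hi h1

/-- For a relation of degree `a + b` without zero coefficients, the values of the forms of
degrees `a` and `b` are orthogonal for a nondegenerate bilinear form. -/
lemma IsRelation.finrank_range_add_finrank_range_le [Fintype ι] {a b : ℕ} {v : ι → σ → k}
    {c : ι → k} (hc : IsRelation (a + b) v c) (h0 : ∀ i, c i ≠ 0) :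
    finrank k (LinearMap.range (evalMap a v)) + finrank k (LinearMap.range (evalMap b v))
      ≤ Fintype.card ι := by
  classical
  set W := LinearMap.range (evalMap a v)
  let T : (ι → k) →ₗ[k] Dual k (ι → k) :=
    { toFun := fun x => ∑ i, (c i * x i) • LinearMap.proj i
      map_add' := fun x y => by simp [mul_add, add_smul, Finset.sum_add_distrib]
      map_smul' := fun r x => by simp [Finset.smul_sum, smul_smul, mul_left_comm] }
  have hT : ∀ x y, T x y = ∑ i, c i * x i * y i := fun x y => by simp [T]
  have hTi : Function.Injective T := by
    rw [← LinearMap.ker_eq_bot, LinearMap.ker_eq_bot']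
    intro x hx
    ext i
    have := congrArg (fun l => l (Pi.single i 1)) hx
    simp only [hT, LinearMap.zero_apply, Pi.single_apply, mul_ite, mul_one, mul_zero,
      Finset.sum_ite_eq', Finset.mem_univ, if_true] at this
    simpa [h0 i] using this
  have hle : (LinearMap.range (evalMap b v)).map T ≤ W.dualAnnihilator := by
    rintro _ ⟨_, ⟨g, rfl⟩, rfl⟩
    rw [Submodule.mem_dualAnnihilator]
    rintro _ ⟨f, rfl⟩
    rw [hT]
    simpa [mul_comm, mul_left_comm, mul_assoc] using hc _ (f.2.mul g.2)
  have h1 := Submodule.finrank_mono hle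
  rw [← (Submodule.equivMapOfInjective T hTi _).finrank_eq] at h1
  have h2 := Subspace.finrank_add_finrank_dualAnnihilator_eq W
  rw [Module.finrank_fintype_fun_eq_card] at h2
  omega

end Relations

/-! ### The dimension of the space of forms -/

section Dimension

variable {k : Type*} [Field k]

/-- The coordinates of a form of degree `d`: its coefficients at the monomials of degree `d`. -/
def homogeneousSubmoduleEquiv {n : ℕ} (d : ℕ) :
    homogeneousSubmodule (Fin n) k d ≃ₗ[k]
      ((Finset.finsuppAntidiag (Finset.univ : Finset (Fin n)) d) → k) where
  toFun f u := coeff u.1 f.1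
  map_add' f g := by ext; simp
  map_smul' r f := by ext; simp
  invFun x := ⟨∑ u, monomial u.1 (x u), IsHomogeneous.sum _ _ _ fun u _ =>
    isHomogeneous_monomial _ (by
      have := (Finset.mem_finsuppAntidiag.mp u.2).1
      rwa [Finsupp.degree_eq_sum])⟩
  left_inv f := by
    ext u
    simp only [coeff_sum, coeff_monomial]
    by_cases hu : u ∈ Finset.finsuppAntidiag (Finset.univ : Finset (Fin n)) d
    · rw [Finset.sum_eq_single ⟨u, hu⟩] <;> simp +contextual [Subtype.ext_iff]
    · rw [Finset.sum_eq_zero]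
      · symm
        refine f.2.coeff_eq_zero fun h => hu ?_
        rw [Finset.mem_finsuppAntidiag]
        exact ⟨by rwa [Finsupp.degree_eq_sum] at h, by simp⟩
      · rintro ⟨w, hw⟩ _
        rw [if_neg]
        rintro rfl
        exact hu hw
  right_inv x := by
    ext u
    simp only [coeff_sum, coeff_monomial]
    rw [Finset.sum_eq_single u]
    · simp
    · intro w _ hw
      rw [if_neg fun h => hw (Subtype.ext h)]
    · simp

lemma finrank_homogeneousSubmodule (n d : ℕ) :
    finrank k (homogeneousSubmodule (Fin n) k d) = (n + d - 1).choose d := by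
  rw [(homogeneousSubmoduleEquiv d).finrank_eq, Module.finrank_fintype_fun_eq_card,
    Fintype.card_coe, Finset.card_finsuppAntidiag_nat_eq_choose, Finset.card_fin]

instance (n d : ℕ) : FiniteDimensional k (homogeneousSubmodule (Fin n) k d) :=
  Module.Finite.equiv (homogeneousSubmoduleEquiv d).symm

end Dimension

/-! ### Factors of forms -/

section HomogeneousFactors

variable {k : Type*} [Field k] {σ : Type*}

/-- The substitution `p(x) ↦ p(T x)`, whose coefficients in `T` are the homogeneous components
of `p`. -/
def scaleVars : MvPolynomial σ k →+* Polynomial (MvPolynomial σ k) :=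
  eval₂Hom (Polynomial.C.comp C) fun s => Polynomial.C (X s) * Polynomial.X

lemma scaleVars_monomial (u : σ →₀ ℕ) (r : k) :
    scaleVars (monomial u r) = Polynomial.C (monomial u r) * Polynomial.X ^ u.degree := by
  rw [scaleVars, coe_eval₂Hom, eval₂_monomial, monomial_eq (s := u)]
  simp only [mul_pow, Finsupp.prod_mul, RingHom.comp_apply, map_mul]
  rw [mul_assoc]
  congr 2
  · simp only [Finsupp.prod, map_prod, map_pow]
  · simp only [Finsupp.prod, Finset.prod_pow_eq_pow_sum, Finsupp.degree_apply]

lemma coeff_scaleVars (p : MvPolynomial σ k) (n : ℕ) :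
    (scaleVars p).coeff n = homogeneousComponent n p := by
  have hmon : ∀ (u : σ →₀ ℕ) (r : k),
      (scaleVars (monomial u r)).coeff n = homogeneousComponent n (monomial u r) := by
    intro u r
    rw [scaleVars_monomial, Polynomial.coeff_C_mul_X_pow,
      homogeneousComponent_of_mem (isHomogeneous_monomial r rfl)]
  induction p using MvPolynomial.monomial_add_induction_on with
  | C a => exact hmon 0 a
  | monomial_add u r f _ _ ih => rw [map_add, map_add, Polynomial.coeff_add, ih, hmon]

lemma scaleVars_ne_zero {p : MvPolynomial σ k} (hp : p ≠ 0) : scaleVars p ≠ 0 := by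
  intro h
  apply hp
  rw [← sum_homogeneousComponent p]
  exact Finset.sum_eq_zero fun i _ => by rw [← coeff_scaleVars, h, Polynomial.coeff_zero]

lemma MvPolynomial.IsHomogeneous.scaleVars_eq {p : MvPolynomial σ k} {n : ℕ}
    (hp : p.IsHomogeneous n) : scaleVars p = Polynomial.C p * Polynomial.X ^ n := by
  ext1 i
  rw [coeff_scaleVars, homogeneousComponent_of_mem hp, Polynomial.coeff_C_mul_X_pow]

/-- The factors of a nonzero form are forms: in `T`, both the degree and the order of `p(T x)`
are additive. -/
lemma exists_isHomogeneous_of_mul {p q : MvPolynomial σ k} {n : ℕ} (h0 : p * q ≠ 0)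
    (h : (p * q).IsHomogeneous n) :
    ∃ a b, a + b = n ∧ p.IsHomogeneous a ∧ q.IsHomogeneous b := by
  have hp : scaleVars p ≠ 0 := scaleVars_ne_zero (left_ne_zero_of_mul h0)
  have hq : scaleVars q ≠ 0 := scaleVars_ne_zero (right_ne_zero_of_mul h0)
  have hs := h.scaleVars_eq
  rw [map_mul] at hs
  have h1 := congrArg Polynomial.natDegree hs
  have h2 := congrArg Polynomial.natTrailingDegree hs
  rw [Polynomial.natDegree_mul hp hq, Polynomial.natDegree_C_mul_X_pow _ _ h0] at h1
  rw [Polynomial.natTrailingDegree_mul hp hq, Polynomial.C_mul_X_pow_eq_monomial,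
    Polynomial.natTrailingDegree_monomial h0] at h2
  have key : ∀ r : MvPolynomial σ k,
      (scaleVars r).natDegree ≤ (scaleVars r).natTrailingDegree →
      r.IsHomogeneous (scaleVars r).natDegree := by
    intro r hr
    have : r = homogeneousComponent (scaleVars r).natDegree r := by
      conv_lhs => rw [← sum_homogeneousComponent r]
      have hz : ∀ i, i ≠ (scaleVars r).natDegree → homogeneousComponent i r = 0 := by
        intro i hi
        rw [← coeff_scaleVars]
        rcases lt_or_gt_of_ne hi with hi | hi
        · exact Polynomial.coeff_eq_zero_of_lt_natTrailingDegree (hi.trans_le hr)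
        · exact Polynomial.coeff_eq_zero_of_natDegree_lt hi
      by_cases hm : (scaleVars r).natDegree ∈ Finset.range (r.totalDegree + 1)
      · exact Finset.sum_eq_single_of_mem _ hm fun i _ hi => hz i hi
      · rw [homogeneousComponent_eq_zero _ _ (by simpa using hm)]
        exact Finset.sum_eq_zero fun i hi => hz i fun h => hm (h ▸ hi)
    rw [this]
    convert homogeneousComponent_isHomogeneous _ _ using 2
    rw [← this]
  have hp' := Polynomial.natTrailingDegree_le_natDegree (scaleVars p)
  have hq' := Polynomial.natTrailingDegree_le_natDegree (scaleVars q)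
  exact ⟨_, _, h1, key p (by omega), key q (by omega)⟩

/-- Dividing two forms by a greatest common divisor. -/
lemma exists_isRelPrime_forms {F G : MvPolynomial σ k} {a b : ℕ} (hF0 : F ≠ 0)
    (hF : F.IsHomogeneous a) (hG0 : G ≠ 0) (hG : G.IsHomogeneous b) :
    ∃ (d a' b' : ℕ) (D F' G' : MvPolynomial σ k), d + a' = a ∧ d + b' = b ∧
      D.IsHomogeneous d ∧ F'.IsHomogeneous a' ∧ G'.IsHomogeneous b' ∧
      D * F' = F ∧ D * G' = G ∧ IsRelPrime F' G' := by
  obtain ⟨F', G', D, hrel, rfl, rfl⟩ :=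
    UniqueFactorizationMonoid.exists_reduced_factors F hF0 G
  obtain ⟨d, a', h1, hD, hF'⟩ := exists_isHomogeneous_of_mul hF0 hF
  obtain ⟨d', b', h2, hD', hG'⟩ := exists_isHomogeneous_of_mul hG0 hG
  obtain rfl := hD.inj_right hD' (left_ne_zero_of_mul hF0)
  exact ⟨d, a', b', D, F', G', h1, h2, hD, hF', hG', rfl, rfl, hrel⟩

end HomogeneousFactors

/-! ### Conditions imposed by points of plane curves -/

section Curves

variable {k : Type*} [Field k] {σ ι : Type*}

/-- Multiplication by a form, between spaces of forms of fixed degrees. -/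
def mulForm {a b d : ℕ} {E : MvPolynomial σ k} (hE : E.IsHomogeneous a) (h : a + b = d) :
    homogeneousSubmodule σ k b →ₗ[k] homogeneousSubmodule σ k d :=
  (LinearMap.mulLeft k E).restrict fun _ hf => h ▸ hE.mul hf

@[simp]
lemma coe_mulForm {a b d : ℕ} {E : MvPolynomial σ k} (hE : E.IsHomogeneous a) (h : a + b = d)
    (f : homogeneousSubmodule σ k b) : (mulForm hE h f : MvPolynomial σ k) = E * f := rfl

lemma mulForm_injective {a b d : ℕ} {E : MvPolynomial σ k} (hE : E.IsHomogeneous a)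
    (hE0 : E ≠ 0) (h : a + b = d) : Function.Injective (mulForm hE h) := by
  intro f g hfg
  have := congrArg Subtype.val hfg
  simp only [coe_mulForm] at this
  exact Subtype.ext (mul_left_cancel₀ hE0 this)

lemma isHomogeneous_right_of_mul {a b : ℕ} {E q : MvPolynomial σ k} (hE : E.IsHomogeneous a)
    (hE0 : E ≠ 0) (h : (E * q).IsHomogeneous (a + b)) : q.IsHomogeneous b := by
  by_cases hq : q = 0
  · rw [hq]; exact isHomogeneous_zero _ _ _
  · obtain ⟨a', b', hab, hE', hq'⟩ := exists_isHomogeneous_of_mul (mul_ne_zero hE0 hq) h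
    obtain rfl := hE.inj_right hE' hE0
    obtain rfl : b' = b := by omega
    exact hq'

lemma eq_zero_of_dvd_of_isHomogeneous_of_lt {a d : ℕ} {E f : MvPolynomial σ k}
    (hE : E.IsHomogeneous a) (hf : f.IsHomogeneous d) (hd : d < a) (h : E ∣ f) : f = 0 := by
  by_contra h0
  obtain ⟨q, rfl⟩ := h
  obtain ⟨a', b', hab, hE', -⟩ := exists_isHomogeneous_of_mul h0 hf
  have := hE.inj_right hE' (left_ne_zero_of_mul h0)
  omega

lemma mem_ker_evalMap {d : ℕ} {v : ι → σ → k} {f : homogeneousSubmodule σ k d} :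
    f ∈ LinearMap.ker (evalMap d v) ↔ ∀ i, eval (v i) (f : MvPolynomial σ k) = 0 := by
  rw [LinearMap.mem_ker, funext_iff]
  simp

lemma range_mulForm_le_ker_evalMap {a b d : ℕ} {E : MvPolynomial σ k} {v : ι → σ → k}
    (hE : E.IsHomogeneous a) (h : a + b = d) (hv : ∀ i, eval (v i) E = 0) :
    LinearMap.range (mulForm hE h) ≤ LinearMap.ker (evalMap d v) := by
  rintro _ ⟨f, rfl⟩
  rw [mem_ker_evalMap]
  intro i
  simp [hv i]

lemma ker_evalMap_le_range_mulForm {a b d : ℕ} {E : MvPolynomial σ k} {v : ι → σ → k}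
    (hE : E.IsHomogeneous a) (hE0 : E ≠ 0) (h : a + b = d)
    (hdvd : ∀ f : MvPolynomial σ k, f.IsHomogeneous d → (∀ i, eval (v i) f = 0) → E ∣ f) :
    LinearMap.ker (evalMap d v) ≤ LinearMap.range (mulForm hE h) := by
  rintro ⟨f, hf⟩ hfk
  obtain ⟨q, rfl⟩ := hdvd f hf (mem_ker_evalMap.mp hfk)
  subst h
  exact ⟨⟨q, isHomogeneous_right_of_mul hE hE0 hf⟩, rfl⟩

lemma finrank_range_evalMap_add {n d : ℕ} {v : ι → Fin n → k} :
    finrank k (LinearMap.range (evalMap d v)) + finrank k (LinearMap.ker (evalMap d v))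
      = finrank k (homogeneousSubmodule (Fin n) k d) :=
  LinearMap.finrank_range_add_finrank_ker _

lemma finrank_range_mulForm {n a b d : ℕ} {E : MvPolynomial (Fin n) k}
    (hE : E.IsHomogeneous a) (hE0 : E ≠ 0) (h : a + b = d) :
    finrank k (LinearMap.range (mulForm hE h)) = finrank k (homogeneousSubmodule (Fin n) k b) :=
  LinearMap.finrank_range_of_inj (mulForm_injective hE hE0 h)

variable (k) in
lemma two_mul_finrank_ternary (d : ℕ) :
    2 * finrank k (homogeneousSubmodule (Fin 3) k d) = (d + 1) * (d + 2) := by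
  rw [finrank_homogeneousSubmodule, show 3 + d - 1 = d + 2 by omega, Nat.choose_symm_add,
    mul_comm, Nat.choose_two_right, Nat.div_mul_cancel]
  · simp [mul_comm]
  · exact (Nat.even_mul_pred_self _).two_dvd

/-- The points of a plane curve impose at most `dim S_d - dim S_{d-a}` conditions. -/
lemma two_mul_finrank_range_evalMap_le {a b d : ℕ} {E : MvPolynomial (Fin 3) k}
    {v : ι → Fin 3 → k} (hE : E.IsHomogeneous a) (hE0 : E ≠ 0) (h : a + b = d)
    (hv : ∀ i, eval (v i) E = 0) :
    2 * finrank k (LinearMap.range (evalMap d v)) + (b + 1) * (b + 2) ≤ (d + 1) * (d + 2) := by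
  have h1 := Submodule.finrank_mono (range_mulForm_le_ker_evalMap hE h hv)
  rw [finrank_range_mulForm hE hE0] at h1
  have h2 := finrank_range_evalMap_add (d := d) (v := v)
  have h3 := two_mul_finrank_ternary k b
  have h4 := two_mul_finrank_ternary k d
  omega

/-- The points lying on a second curve, which does not contain the first one, impose one
condition less. -/
lemma two_mul_finrank_range_evalMap_lt {a b d : ℕ} {E G : MvPolynomial (Fin 3) k}
    {v : ι → Fin 3 → k} (hE : E.IsHomogeneous a) (hE0 : E ≠ 0) (h : a + b = d)
    (hv : ∀ i, eval (v i) E = 0) (hG : G.IsHomogeneous d) (hGv : ∀ i, eval (v i) G = 0)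
    (hEG : ¬ E ∣ G) :
    2 * finrank k (LinearMap.range (evalMap d v)) + (b + 1) * (b + 2) + 2
      ≤ (d + 1) * (d + 2) := by
  have hlt : LinearMap.range (mulForm hE h) < LinearMap.ker (evalMap d v) := by
    refine lt_of_le_of_ne (range_mulForm_le_ker_evalMap hE h hv) fun heq => hEG ?_
    have : (⟨G, hG⟩ : homogeneousSubmodule (Fin 3) k d) ∈ LinearMap.range (mulForm hE h) := by
      rw [heq, mem_ker_evalMap]; exact hGv
    obtain ⟨q, hq⟩ := this
    exact ⟨q, (congrArg Subtype.val hq).symm⟩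
  have h1 := Submodule.finrank_lt_finrank_of_lt hlt
  rw [finrank_range_mulForm hE hE0] at h1
  have h2 := finrank_range_evalMap_add (d := d) (v := v)
  have h3 := two_mul_finrank_ternary k b
  have h4 := two_mul_finrank_ternary k d
  omega

/-- A lower bound for the number of conditions imposed in degree `d` when the only
curves of degree `d` through the points are those containing the given curve of degree `e`. -/
lemma le_two_mul_finrank_range_evalMap {e d : ℕ} {E : MvPolynomial (Fin 3) k}
    {v : ι → Fin 3 → k} (hE : E.IsHomogeneous e) (hE0 : E ≠ 0) (h : e ≤ d + 2)
    (hdvd : ∀ f : MvPolynomial (Fin 3) k, f.IsHomogeneous d → (∀ i, eval (v i) f = 0) → E ∣ f) :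
    (e : ℤ) * (2 * d + 3 - e) ≤ 2 * finrank k (LinearMap.range (evalMap d v)) := by
  have h2 := finrank_range_evalMap_add (d := d) (v := v)
  have h4 := two_mul_finrank_ternary k d
  by_cases hd : d < e
  · have hk : LinearMap.ker (evalMap d v) = ⊥ := by
      rw [eq_bot_iff]
      intro f hf
      have := eq_zero_of_dvd_of_isHomogeneous_of_lt hE f.2 hd
        (hdvd f f.2 (mem_ker_evalMap.mp hf))
      exact Subtype.ext this
    rw [hk, finrank_bot] at h2
    have h5 : (2 * finrank k (LinearMap.range (evalMap d v)) : ℤ) = (d + 1) * (d + 2) := by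
      exact_mod_cast (by omega)
    rw [h5]
    obtain rfl | rfl : e = d + 1 ∨ e = d + 2 := by omega
    · push_cast; nlinarith
    · push_cast; nlinarith
  · obtain ⟨b, rfl⟩ := Nat.exists_eq_add_of_le (not_lt.mp hd)
    have h1 := Submodule.finrank_mono (ker_evalMap_le_range_mulForm hE hE0 rfl hdvd)
    rw [finrank_range_mulForm hE hE0] at h1
    have h3 := two_mul_finrank_ternary k b
    zify at h1 h2 h3 h4
    push_cast
    nlinarith

lemma eq_C_of_isHomogeneous_zero {E : MvPolynomial σ k} (hE : E.IsHomogeneous 0) :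
    ∃ r, E = C r :=
  ⟨_, totalDegree_eq_zero_iff_eq_C.mp (Nat.le_zero.mp hE.totalDegree_le)⟩

/-- Bézout's bound for the number of common points of two plane curves. In large degree, the
ideal `(E, G)` has codimension `a * b`, and the points impose independent conditions. -/
lemma card_le_mul_of_isRelPrime [Fintype ι] {a b : ℕ} {E G : MvPolynomial (Fin 3) k}
    {v : ι → Fin 3 → k} (hv : IsProjectivelyDistinct v) (hE : E.IsHomogeneous a) (hE0 : E ≠ 0)
    (hG : G.IsHomogeneous b) (hrel : IsRelPrime E G)
    (hEv : ∀ i, eval (v i) E = 0) (hGv : ∀ i, eval (v i) G = 0) :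
    Fintype.card ι ≤ a * b := by
  set n := Fintype.card ι with hn
  set d := a + b + n with hd
  have hdE : a + (b + n) = d := by omega
  have hdG : b + (a + n) = d := by omega
  -- the kernel of `T`, the syzygies of `E` and `G`, is the image of `K`
  let T := (mulForm hE hdE).coprod (mulForm hG hdG)
  let K := (mulForm (d := b + n) hG rfl).prod (-(mulForm (b := n) (d := a + n) hE rfl))
  have hker : LinearMap.ker T ≤ LinearMap.range K := by
    rintro ⟨⟨A, hA⟩, ⟨B, hB⟩⟩ h
    have h' : E * A + G * B = 0 := congrArg Subtype.val (LinearMap.mem_ker.mp h)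
    obtain ⟨q, rfl⟩ : E ∣ B :=
      hrel.dvd_of_dvd_mul_left ⟨-A, by linear_combination h'⟩
    refine ⟨⟨-q, (isHomogeneous_right_of_mul hE hE0 hB).neg⟩, ?_⟩
    have hA' : G * -q = A := mul_left_cancel₀ hE0 (by linear_combination -h')
    refine Prod.ext (Subtype.ext hA') (Subtype.ext ?_)
    simp [K]
  have hrange : LinearMap.range T ≤ LinearMap.ker (evalMap d v) := by
    rw [LinearMap.range_coprod]
    exact sup_le (range_mulForm_le_ker_evalMap hE _ hEv) (range_mulForm_le_ker_evalMap hG _ hGv)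
  have h1 := Submodule.finrank_mono hker
  have h2 := LinearMap.finrank_range_le K
  have h3 := Submodule.finrank_mono hrange
  have h4 := LinearMap.finrank_range_add_finrank_ker T
  rw [Module.finrank_prod] at h4
  have h5 := finrank_range_evalMap_add (d := d) (v := v)
  have h6 : n ≤ finrank k (LinearMap.range (evalMap d v)) := by
    by_contra! hlt
    obtain ⟨c, hc0, hc⟩ := finrank_range_evalMap_lt_iff.mp hlt
    have h7 := hc.add_two_le_ncard_support hv hc0
    have h8 := Set.ncard_le_card (Function.support c)
    rw [Nat.card_eq_fintype_card] at h8
    omega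
  have e1 := two_mul_finrank_ternary k (b + n)
  have e2 := two_mul_finrank_ternary k (a + n)
  have e3 := two_mul_finrank_ternary k n
  have e4 := two_mul_finrank_ternary k d
  have e5 : (d + 1) * (d + 2) + (n + 1) * (n + 2) =
    (b + n + 1) * (b + n + 2) + (a + n + 1) * (a + n + 2) + 2 * (a * b) := by rw [hd]; ring
  omega

end Curves

/-! ### Relations between points of the plane -/

section Plane

universe u

variable {k : Type*} [Field k] {σ : Type*} {ι : Type u}

lemma IsProjectivelyDistinct.comp {v : ι → σ → k} (hv : IsProjectivelyDistinct v) {κ : Type*}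
    {f : κ → ι} (hf : Function.Injective f) : IsProjectivelyDistinct (v ∘ f) :=
  ⟨fun _ => hv.1 _, fun _ _ h => hv.2 _ _ (hf.ne h)⟩

open Classical in
/-- A relation restricts to the points which it involves. -/
lemma IsRelation.restrict [Fintype ι] {m : ℕ} {v : ι → σ → k} {c : ι → k} (hc : IsRelation m v c)
    {p : ι → Prop} [Fintype {i // p i}] (hp : ∀ i, c i ≠ 0 → p i) :
    IsRelation m (fun i : {i // p i} => v i) (fun i => c i) := by
  intro f hf
  rw [← hc f hf, ← Finset.sum_subtype (Finset.univ.filter p) (by simp)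
    (fun i => c i * eval (v i) f)]
  refine Finset.sum_subset (Finset.subset_univ _) fun i _ hi => ?_
  have : c i = 0 := by
    by_contra h
    exact hi (by simpa using hp i h)
  simp [this]

open Classical in
/-- The points outside a hypersurface of degree `d` inherit a relation, of degree smaller
by `d`. -/
lemma IsRelation.residual [Fintype ι] {d m : ℕ} {v : ι → σ → k} {c : ι → k}
    (hc : IsRelation (d + m) v c)
    {D : MvPolynomial σ k} (hD : D.IsHomogeneous d) :
    IsRelation m (fun i : {i // eval (v i) D ≠ 0} => v i) (fun i => c i * eval (v i) D) :=
  (hc.mul hD).restrict fun _ hi => right_ne_zero_of_mul hi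

/-- Let `E` be the equation of a plane curve of minimal degree through the points, and `G` the
equation of a curve through the points which does not contain it. The greatest common divisor
of `E` and `G` does not vanish at all the points. -/
lemma exists_isRelPrime_residual {ι : Type*} {v : ι → Fin 3 → k} {e f : ℕ}
    {E G : MvPolynomial (Fin 3) k} (hE : E.IsHomogeneous e) (hE0 : E ≠ 0)
    (hEv : ∀ i, eval (v i) E = 0)
    (hmin : ∀ e' : ℕ, ∀ E' : MvPolynomial (Fin 3) k, E' ≠ 0 → E'.IsHomogeneous e' →
      (∀ i, eval (v i) E' = 0) → e ≤ e')
    (hG : G.IsHomogeneous f) (hGv : ∀ i, eval (v i) G = 0) (hEG : ¬ E ∣ G) :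
    ∃ (d e' f' : ℕ) (D E' G' : MvPolynomial (Fin 3) k), d + e' = e ∧ d + f' = f ∧ d < e ∧
      D.IsHomogeneous d ∧ E'.IsHomogeneous e' ∧ E' ≠ 0 ∧ G'.IsHomogeneous f' ∧ G' ≠ 0 ∧
      D * E' = E ∧ D * G' = G ∧ IsRelPrime E' G' ∧ (∃ i, eval (v i) D ≠ 0) ∧
      ∀ i, eval (v i) D ≠ 0 → eval (v i) E' = 0 ∧ eval (v i) G' = 0 := by
  have hG0 : G ≠ 0 := fun h => hEG (h ▸ dvd_zero E)
  obtain ⟨d, e', f', D, E', G', hde, hdf, hD, hE', hG', rfl, rfl, hrel⟩ :=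
    exists_isRelPrime_forms hE0 hE hG0 hG
  have hlt : d < e := by
    by_contra! hle
    obtain rfl : e' = 0 := by omega
    obtain ⟨r, rfl⟩ := eq_C_of_isHomogeneous_zero hE'
    have hr : IsUnit (C r : MvPolynomial (Fin 3) k) :=
      (IsUnit.mk0 r fun h => by simp [h] at hE0).map C
    exact hEG ((hr.mul_right_dvd).mpr (dvd_mul_right _ _))
  refine ⟨d, e', f', D, E', G', hde, hdf, hlt, hD, hE', right_ne_zero_of_mul hE0, hG',
    right_ne_zero_of_mul hG0, rfl, rfl, hrel, ?_, fun i hi => ?_⟩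
  · by_contra! h
    exact absurd (hmin d D (left_ne_zero_of_mul hE0) hD h) (by omega)
  · have h1 := hEv i
    have h2 := hGv i
    rw [map_mul] at h1 h2
    exact ⟨(mul_eq_zero.mp h1).resolve_left hi, (mul_eq_zero.mp h2).resolve_left hi⟩

lemma exists_eval_X_ne_zero {v : σ → k} (hv : v ≠ 0) :
    ∃ s, eval v (X s : MvPolynomial σ k) ≠ 0 := by
  obtain ⟨s, hs⟩ := Function.ne_iff.mp hv
  exact ⟨s, by simpa using hs⟩

open Classical in
/-- Among the points common to two plane curves of degrees `a` and `b` without common component,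
there is no nontrivial relation of degree larger than `a + b - 3`. The proof is by induction on
the degree of the relation: a common factor of the two curves of lowest degree through the points
is removed by passing to a residual set, and without one, the orthogonality of values contradicts
Bézout's bound. -/
theorem IsRelation.add_three_le_of_isRelPrime (m : ℕ) {ι : Type u} [Fintype ι] [Nonempty ι]
    {v : ι → Fin 3 → k} {c : ι → k} (hv : IsProjectivelyDistinct v) (hc : IsRelation m v c)
    (h0 : ∀ i, c i ≠ 0) {a b : ℕ} {A B : MvPolynomial (Fin 3) k} (hA : A.IsHomogeneous a)
    (hA0 : A ≠ 0) (hB : B.IsHomogeneous b) (hB0 : B ≠ 0) (hrel : IsRelPrime A B)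
    (hAv : ∀ i, eval (v i) A = 0) (hBv : ∀ i, eval (v i) B = 0) : m + 3 ≤ a + b := by
  induction m using Nat.strong_induction_on generalizing ι a b A B with
  | _ m ih =>
  by_contra! hab
  -- a curve of minimal degree through the points
  have hex : ∃ e, ∃ E : MvPolynomial (Fin 3) k, E ≠ 0 ∧ E.IsHomogeneous e ∧
      ∀ i, eval (v i) E = 0 := ⟨a, A, hA0, hA, hAv⟩
  obtain ⟨E, hE0, hE, hEv⟩ := Nat.find_spec hex
  have hmin : ∀ e' : ℕ, ∀ E' : MvPolynomial (Fin 3) k, E' ≠ 0 → E'.IsHomogeneous e' →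
      (∀ i, eval (v i) E' = 0) → Nat.find hex ≤ e' :=
    fun e' E' h1 h2 h3 => Nat.find_min' hex ⟨E', h1, h2, h3⟩
  set e := Nat.find hex
  clear_value e
  have he1 : 1 ≤ e := by
    by_contra! h
    obtain rfl : e = 0 := by omega
    obtain ⟨r, rfl⟩ := eq_C_of_isHomogeneous_zero hE
    have := hEv (Classical.arbitrary ι)
    rw [eval_C] at this
    simp [this] at hE0
  -- a curve of minimal degree among those which do not contain the first one
  have hex' : ∃ f, ∃ G : MvPolynomial (Fin 3) k, G.IsHomogeneous f ∧
      (∀ i, eval (v i) G = 0) ∧ ¬ E ∣ G ∧ e + f ≤ a + b := by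
    by_cases hEA : E ∣ A
    · refine ⟨b, B, hB, hBv, fun hEB => ?_, by have := hmin a A hA0 hA hAv; omega⟩
      have := (hrel hEA hEB).map (eval (v (Classical.arbitrary ι)))
      rw [hEv] at this
      exact not_isUnit_zero this
    · exact ⟨a, A, hA, hAv, hEA, by have := hmin b B hB0 hB hBv; omega⟩
  obtain ⟨G, hG, hGv, hEG, hef⟩ := Nat.find_spec hex'
  have hdvd : ∀ j < Nat.find hex', ∀ G' : MvPolynomial (Fin 3) k, G'.IsHomogeneous j →
      (∀ i, eval (v i) G' = 0) → E ∣ G' := by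
    intro j hj G' h1 h2
    by_contra h3
    exact Nat.find_min hex' hj ⟨G', h1, h2, h3, by omega⟩
  set f := Nat.find hex'
  clear_value f
  have hef' : e ≤ f := hmin f G (fun h => hEG (h ▸ dvd_zero E)) hG hGv
  obtain ⟨d, e', f', D, E', G', hde, hdf, hlt, hD, hE', hE0', hG', hG0', rfl, rfl, hrel',
    ⟨i₀, hi₀⟩, hv'⟩ := exists_isRelPrime_residual hE hE0 hEv hmin hG hGv hEG
  -- induction, applied to the points at which a form `Q` of degree `j` does not vanish
  have hres : ∀ (j : ℕ) (Q : MvPolynomial (Fin 3) k), 1 ≤ j → j ≤ m → Q.IsHomogeneous j →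
      eval (v i₀) Q ≠ 0 → (∀ i, eval (v i) Q ≠ 0 → eval (v i) D ≠ 0) → m - j + 3 ≤ e' + f' := by
    intro j Q hj hjm hQ hQi hQD
    have hc' : IsRelation (j + (m - j)) v c := by rwa [Nat.add_sub_cancel' hjm]
    have : Nonempty {i // eval (v i) Q ≠ 0} := ⟨⟨i₀, hQi⟩⟩
    exact ih (m - j) (by omega) (hv.comp Subtype.val_injective) (hc'.residual hQ)
      (fun i => mul_ne_zero (h0 i) i.2) hE' hE0' hG' hG0' hrel'
      (fun i => (hv' i (hQD i i.2)).1) (fun i => (hv' i (hQD i i.2)).2)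
  rcases Nat.eq_zero_or_pos d with rfl | hd
  · rw [zero_add] at hde hdf
    subst hde hdf
    have hDi : ∀ i, eval (v i) D ≠ 0 := by
      obtain ⟨r, rfl⟩ := eq_C_of_isHomogeneous_zero hD
      simpa using hi₀
    have hcard := card_le_mul_of_isRelPrime hv hE' hE0' hG' hrel'
      (fun i => (hv' i (hDi i)).1) (fun i => (hv' i (hDi i)).2)
    have h2f : m + 2 ≤ 2 * f' := by
      rcases Nat.eq_zero_or_pos m with rfl | hm
      · omega
      · obtain ⟨s, hs⟩ := exists_eval_X_ne_zero (hv.1 i₀)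
        have := hres 1 (X s) le_rfl hm (isHomogeneous_X _ _) hs fun i _ => hDi i
        omega
    -- the conditions imposed in degrees `f' - 1` and `m + 1 - f'` add up to `e' (m + 3 - e')`,
    -- which is at most the number of points, hence at most `e' f'`
    have hc' : IsRelation ((f' - 1) + (m + 1 - f')) v c := by
      rwa [show (f' - 1) + (m + 1 - f') = m by omega]
    have h1 := hc'.finrank_range_add_finrank_range_le h0
    have h2 := le_two_mul_finrank_range_evalMap (d := f' - 1) hE hE0 (by omega)
      (hdvd _ (by omega))
    have h3 := le_two_mul_finrank_range_evalMap (d := m + 1 - f') hE hE0 (by omega)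
      (hdvd _ (by omega))
    rw [Nat.cast_sub (by omega)] at h2 h3
    zify at h1 hcard hab hef he1
    push_cast at h2 h3
    have h4 : (e' : ℤ) * (m + 3 - e') ≤ e' * f' := by nlinarith
    have h5 := le_of_mul_le_mul_left h4 (by omega)
    omega
  · have := hres d D hd (by omega) hD hi₀ fun i hi => hi
    omega

open Classical in
/-- Let `E` be the equation of a plane curve of minimal degree through the points of a relation
of degree `m`, and `G` the equation of a curve through these points which does not contain it.
If `D` is their greatest common divisor, the points outside `D` still support a relation, of
degree `m - deg D`, and they are common to the coprime curves `E / D` and `G / D`. -/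
theorem IsRelation.add_three_le_of_minimal {m : ℕ} {ι : Type u} [Fintype ι]
    {v : ι → Fin 3 → k} {c : ι → k} (hv : IsProjectivelyDistinct v) (hc : IsRelation m v c)
    (h0 : ∀ i, c i ≠ 0) {e f : ℕ} {E G : MvPolynomial (Fin 3) k} (hem : e ≤ m + 1)
    (hE : E.IsHomogeneous e) (hE0 : E ≠ 0) (hEv : ∀ i, eval (v i) E = 0)
    (hmin : ∀ e' : ℕ, ∀ E' : MvPolynomial (Fin 3) k, E' ≠ 0 → E'.IsHomogeneous e' →
      (∀ i, eval (v i) E' = 0) → e ≤ e')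
    (hG : G.IsHomogeneous f) (hGv : ∀ i, eval (v i) G = 0) (hEG : ¬ E ∣ G) :
    m + 3 ≤ e + f ∧ (e + f = m + 3 → IsRelPrime E G) := by
  obtain ⟨d, e', f', D, E', G', hde, hdf, hlt, hD, hE', hE0', hG', hG0', rfl, rfl, hrel',
    ⟨i₀, hi₀⟩, hv'⟩ := exists_isRelPrime_residual hE hE0 hEv hmin hG hGv hEG
  have hc' : IsRelation (d + (m - d)) v c := by rwa [Nat.add_sub_cancel' (by omega)]
  have : Nonempty {i // eval (v i) D ≠ 0} := ⟨⟨i₀, hi₀⟩⟩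
  have h := (hc'.residual hD).add_three_le_of_isRelPrime _ (hv.comp Subtype.val_injective)
      (fun i => mul_ne_zero (h0 i) i.2) hE' hE0' hG' hG0' hrel'
      (fun i => (hv' i i.2).1) (fun i => (hv' i i.2).2)
  refine ⟨by omega, fun hm => ?_⟩
  obtain rfl : d = 0 := by omega
  obtain ⟨r, rfl⟩ := eq_C_of_isHomogeneous_zero hD
  have hr : IsUnit (C r : MvPolynomial (Fin 3) k) :=
    (IsUnit.mk0 r fun h => by simp [h] at hi₀).map C
  exact (isRelPrime_mul_unit_left hr).mpr hrel'

/-- Plane curves through finitely many points exist. -/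
lemma exists_form_vanishing [Fintype ι] (v : ι → Fin 3 → k) :
    ∃ e, ∃ E : MvPolynomial (Fin 3) k, E ≠ 0 ∧ E.IsHomogeneous e ∧ ∀ i, eval (v i) E = 0 := by
  by_contra! h
  have h1 := finrank_range_evalMap_add (d := Fintype.card ι) (v := v)
  have h2 := two_mul_finrank_ternary k (Fintype.card ι)
  have h3 := (Submodule.finrank_le (LinearMap.range (evalMap (Fintype.card ι) v)))
  rw [Module.finrank_fintype_fun_eq_card] at h3
  have h4 : LinearMap.ker (evalMap (Fintype.card ι) v) ≠ ⊥ := by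
    intro h'
    rw [h', finrank_bot] at h1
    nlinarith
  obtain ⟨f, hf, hf0⟩ := Submodule.exists_mem_ne_zero_of_ne_bot h4
  obtain ⟨i, hi⟩ := h _ f (fun h => hf0 (Subtype.ext h)) f.2
  exact hi (mem_ker_evalMap.mp hf i)

/-- At most `3 m` points of the plane which support a relation of degree `m` lie on a line,
or on a conic, or are the points common to a cubic and a curve of degree `m`. -/
theorem IsRelation.plane_classification {m : ℕ} {ι : Type u} [Fintype ι] [Nonempty ι]
    {v : ι → Fin 3 → k} {c : ι → k} (hv : IsProjectivelyDistinct v) (hc : IsRelation m v c)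
    (h0 : ∀ i, c i ≠ 0) (hcard : Fintype.card ι ≤ 3 * m) :
    (∃ E : MvPolynomial (Fin 3) k, E ≠ 0 ∧ E.IsHomogeneous 1 ∧ ∀ i, eval (v i) E = 0) ∨
    (2 * m + 2 ≤ Fintype.card ι ∧
      ∃ E : MvPolynomial (Fin 3) k, E ≠ 0 ∧ E.IsHomogeneous 2 ∧ ∀ i, eval (v i) E = 0) ∨
    (3 ≤ m ∧ Fintype.card ι = 3 * m ∧ ∃ E G : MvPolynomial (Fin 3) k, E ≠ 0 ∧ G ≠ 0 ∧
      E.IsHomogeneous 3 ∧ G.IsHomogeneous m ∧ IsRelPrime E G ∧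
      (∀ i, eval (v i) E = 0) ∧ ∀ i, eval (v i) G = 0) := by
  classical
  have hm : 1 ≤ m := by
    have := Fintype.card_pos (α := ι)
    omega
  have hex := exists_form_vanishing v
  obtain ⟨E, hE0, hE, hEv⟩ := Nat.find_spec hex
  have hmin : ∀ e' : ℕ, ∀ E' : MvPolynomial (Fin 3) k, E' ≠ 0 → E'.IsHomogeneous e' →
      (∀ i, eval (v i) E' = 0) → Nat.find hex ≤ e' :=
    fun e' E' h1 h2 h3 => Nat.find_min' hex ⟨E', h1, h2, h3⟩
  set e := Nat.find hex
  clear_value e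
  have he1 : 1 ≤ e := by
    by_contra! h
    obtain rfl : e = 0 := by omega
    obtain ⟨r, rfl⟩ := eq_C_of_isHomogeneous_zero hE
    have := hEv (Classical.arbitrary ι)
    rw [eval_C] at this
    simp [this] at hE0
  have hlow : ∀ j < e, ∀ f : MvPolynomial (Fin 3) k, f.IsHomogeneous j →
      (∀ i, eval (v i) f = 0) → E ∣ f := by
    intro j hj f hf hfv
    by_contra h
    exact absurd (hmin j f (fun h' => h (h' ▸ dvd_zero E)) hf hfv) (by omega)
  by_cases hem : 2 * e ≤ m + 3
  · have hall : ∀ f : MvPolynomial (Fin 3) k, f.IsHomogeneous (m + 1 - e) →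
        (∀ i, eval (v i) f = 0) → E ∣ f := by
      intro f hf hfv
      by_contra h
      have := (hc.add_three_le_of_minimal hv h0 (by omega) hE hE0 hEv hmin hf hfv h).1
      omega
    -- in degrees `e - 1` and `m + 1 - e`, all curves through the points contain `E`, and the
    -- numbers of conditions imposed by the points add up to `e (m + 3 - e)`
    have hc' : IsRelation ((e - 1) + (m + 1 - e)) v c := by
      rwa [show (e - 1) + (m + 1 - e) = m by omega]
    have h1 := hc'.finrank_range_add_finrank_range_le h0
    have h2 := le_two_mul_finrank_range_evalMap (d := e - 1) hE hE0 (by omega)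
      (hlow _ (by omega))
    have h3 := le_two_mul_finrank_range_evalMap (d := m + 1 - e) hE hE0 (by omega) hall
    rw [Nat.cast_sub (by omega)] at h2 h3
    push_cast at h2 h3
    have h4 : (e : ℤ) * (m + 3 - e) ≤ Fintype.card ι := by
      zify at h1
      nlinarith
    have he3 : e ≤ 3 := by
      by_contra! h
      zify at hcard h hem
      have h5 : 0 < ((e : ℤ) - 3) * (m - e) := mul_pos (by omega) (by omega)
      nlinarith
    obtain rfl | rfl | rfl : e = 1 ∨ e = 2 ∨ e = 3 := by omega
    · exact Or.inl ⟨E, hE0, hE, hEv⟩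
    · exact Or.inr (Or.inl ⟨by push_cast at h4; omega, E, hE0, hE, hEv⟩)
    · obtain ⟨b, rfl⟩ := Nat.exists_eq_add_of_le (show 3 ≤ m by omega)
      have hcard' : Fintype.card ι = 3 * (3 + b) := by push_cast at h4; omega
      refine Or.inr (Or.inr ⟨by omega, hcard', ?_⟩)
      -- the relation leaves room for a curve of degree `m` not containing the cubic
      obtain ⟨G, hG, hGv, hEG⟩ : ∃ G : MvPolynomial (Fin 3) k, G.IsHomogeneous (3 + b) ∧
          (∀ i, eval (v i) G = 0) ∧ ¬ E ∣ G := by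
        by_contra! hno
        have h5 := le_two_mul_finrank_range_evalMap (d := 3 + b) hE hE0 (by omega) hno
        have h6 := finrank_range_evalMap_lt_iff.mpr
          ⟨c, Function.ne_iff.mpr ⟨Classical.arbitrary ι, h0 _⟩, hc⟩
        push_cast at h5
        omega
      have hrel := (hc.add_three_le_of_minimal hv h0 (by omega) hE hE0 hEv hmin hG hGv hEG).2
        (by omega)
      exact ⟨E, G, hE0, fun h => hEG (h ▸ dvd_zero E), hE, hG, hrel, hEv, hGv⟩
  · -- no curve of degree about `m / 2` passes through the points: there are too many of them
    exfalso
    have key : ∀ j ≤ m, j < e → m - j < e →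
        (j + 1) * (j + 2) + (m - j + 1) * (m - j + 2) ≤ 6 * m := by
      intro j hj hje hmj
      have hrank : ∀ i < e, 2 * finrank k (LinearMap.range (evalMap i v)) = (i + 1) * (i + 2) := by
        intro i hi
        have hk : LinearMap.ker (evalMap i v) = ⊥ := by
          rw [eq_bot_iff]
          intro f hf
          exact Subtype.ext (eq_zero_of_dvd_of_isHomogeneous_of_lt hE f.2 hi
            (hlow i hi f f.2 (mem_ker_evalMap.mp hf)))
        have h2 := finrank_range_evalMap_add (d := i) (v := v)
        rw [hk, finrank_bot, add_zero] at h2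
        rw [h2, two_mul_finrank_ternary]
      have hc' : IsRelation (j + (m - j)) v c := by rwa [Nat.add_sub_cancel' hj]
      have h1 := hc'.finrank_range_add_finrank_range_le h0
      have h2 := hrank _ hje
      have h3 := hrank _ hmj
      omega
    by_cases h4 : m ≤ 4
    · interval_cases m
      · have := key 1 (by omega) (by omega) (by omega); omega
      · have := key 2 (by omega) (by omega) (by omega); omega
      · have := key 3 (by omega) (by omega) (by omega); omega
      · have := key 3 (by omega) (by omega) (by omega); omega
    · obtain ⟨j, rfl | rfl⟩ := Nat.even_or_odd' m
      · have := key j (by omega) (by omega) (by omega)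
        rw [show 2 * j - j = j by omega] at this
        nlinarith
      · have := key j (by omega) (by omega) (by omega)
        rw [show 2 * j + 1 - j = j + 1 by omega] at this
        nlinarith

end Plane

/-! ### Relations between points of projective space -/

section Space

variable {k : Type*} [Field k] {σ ι : Type*}

/-- Cutting the points of a relation by a hyperplane which contains a given subspace `W`, but not
a given point. -/
lemma IsRelation.exists_hyperplane_residual [Fintype ι] [Fintype σ] {m : ℕ} {v : ι → σ → k}
    {c : ι → k}
    (hc : IsRelation (m + 1) v c) (W : Submodule k (σ → k)) {t : ι} (ht : c t ≠ 0)
    (htW : v t ∉ W) :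
    ∃ c' : ι → k, IsRelation m v c' ∧ c' ≠ 0 ∧
      ∀ i, c' i ≠ 0 → c i ≠ 0 ∧ v i ∉ W := by
  classical
  obtain ⟨l, hl, hW⟩ := Submodule.exists_le_ker_of_notMem htW
  rw [add_comm] at hc
  refine ⟨fun i => c i * eval (v i) (linearForm l), hc.mul (isHomogeneous_linearForm l),
    Function.ne_iff.mpr ⟨t, by simpa using ⟨ht, hl⟩⟩, fun i hi => ?_⟩
  simp only [eval_linearForm] at hi
  exact ⟨left_ne_zero_of_mul hi, fun h => right_ne_zero_of_mul hi (hW h)⟩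

lemma IsProjectivelyDistinct.finrank_span_pair {v : ι → σ → k} (hv : IsProjectivelyDistinct v)
    {i j : ι} (hij : i ≠ j) : finrank k (Submodule.span k {v i, v j}) = 2 := by
  have h : LinearIndependent k ![v j, v i] := by
    rw [LinearIndependent.pair_iff' (hv.1 j)]
    intro a ha
    exact hv.2 i j hij (ha ▸ Submodule.smul_mem _ _ (Submodule.mem_span_singleton_self _))
  have he : Set.range ![v j, v i] = {v i, v j} := by
    simp [Set.pair_comm]
  rw [← he, finrank_span_eq_card h, Fintype.card_fin]

lemma IsProjectivelyDistinct.eq_span_pair [Finite σ] {v : ι → σ → k} (hv : IsProjectivelyDistinct v)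
    {i j : ι} (hij : i ≠ j) {L : Submodule k (σ → k)} (hL : finrank k L ≤ 2) (hi : v i ∈ L)
    (hj : v j ∈ L) : L = Submodule.span k {v i, v j} := by
  symm
  apply Submodule.eq_of_le_of_finrank_le
  · rw [Submodule.span_le]
    rintro x (rfl | rfl) <;> assumption
  · rwa [hv.finrank_span_pair hij]

/-- At most `2 m + 1` points which support a relation of degree `m` are collinear: otherwise,
cutting by a hyperplane leaves, by induction, points on a line, and cutting by a hyperplane
through this line leaves `m + 1` points more. -/
theorem IsRelation.exists_line [Fintype ι] [Fintype σ] {m : ℕ} {v : ι → σ → k} {c : ι → k}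
    (hv : IsProjectivelyDistinct v) (hc : IsRelation m v c) (h0 : c ≠ 0)
    (hcard : (Function.support c).ncard ≤ 2 * m + 1) :
    ∃ L : Submodule k (σ → k), finrank k L ≤ 2 ∧ ∀ i, c i ≠ 0 → v i ∈ L := by
  classical
  induction m generalizing c with
  | zero =>
    have := hc.add_two_le_ncard_support hv h0
    omega
  | succ m ih =>
    by_contra! hno
    obtain ⟨i, j, hi, hj, hij⟩ := (Set.one_lt_ncard_iff (Set.toFinite _)).mp
      (show 1 < (Function.support c).ncard by
        have := hc.add_two_le_ncard_support hv h0; omega)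
    obtain ⟨t, ht, htL⟩ := hno _ (hv.finrank_span_pair hij).le
    obtain ⟨c', hc', h0', hsub⟩ := hc.exists_hyperplane_residual _ ht htL
    have hge := hc'.add_two_le_ncard_support hv h0'
    have hle : (Function.support c').ncard + ({i, j} : Set ι).ncard ≤
        (Function.support c).ncard := by
      rw [← Set.ncard_union_eq _ (Set.toFinite _) (Set.toFinite _)]
      · refine Set.ncard_le_ncard ?_ (Set.toFinite _)
        rintro x (hx | rfl | rfl)
        exacts [(hsub x hx).1, hi, hj]
      · rw [Set.disjoint_left]
        rintro x hx (rfl | rfl)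
        · exact (hsub _ hx).2 (Submodule.subset_span (by simp))
        · exact (hsub _ hx).2 (Submodule.subset_span (by simp))
    rw [Set.ncard_pair hij] at hle
    obtain ⟨L, hL, hLc⟩ := ih hc' h0' (by omega)
    obtain ⟨s, hs, hsL⟩ := hno L hL
    obtain ⟨c'', hc'', h0'', hsub'⟩ := hc.exists_hyperplane_residual _ hs hsL
    have hge' := hc''.add_two_le_ncard_support hv h0''
    have hle' : (Function.support c').ncard + (Function.support c'').ncard ≤
        (Function.support c).ncard := by
      rw [← Set.ncard_union_eq _ (Set.toFinite _) (Set.toFinite _)]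
      · refine Set.ncard_le_ncard ?_ (Set.toFinite _)
        rintro x (hx | hx)
        exacts [(hsub x hx).1, (hsub' x hx).1]
      · rw [Set.disjoint_left]
        exact fun x hx hx' => (hsub' x hx').2 (hLc x hx)
    omega

/-- Among at most `3 m` points which support a relation of degree `m`, at least `m + 2` are
collinear, or all are coplanar. -/
theorem IsRelation.exists_line_or_plane [Fintype ι] [Fintype σ] {m : ℕ} {v : ι → σ → k} {c : ι → k}
    (hv : IsProjectivelyDistinct v) (hc : IsRelation m v c) (h0 : c ≠ 0)
    (hcard : (Function.support c).ncard ≤ 3 * m) :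
    (∃ L : Submodule k (σ → k), finrank k L ≤ 2 ∧
      m + 2 ≤ {i | c i ≠ 0 ∧ v i ∈ L}.ncard) ∨
    ∃ W : Submodule k (σ → k), finrank k W ≤ 3 ∧ ∀ i, c i ≠ 0 → v i ∈ W := by
  classical
  induction m generalizing c with
  | zero =>
    have := hc.add_two_le_ncard_support hv h0
    omega
  | succ m ih =>
    by_contra! h
    obtain ⟨hline, hplane⟩ := h
    -- each plane misses at least `m + 2` of the points
    have hcut : ∀ W : Submodule k (σ → k), finrank k W ≤ 3 → ∃ c' : ι → k, IsRelation m v c' ∧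
        c' ≠ 0 ∧ (∀ i, c' i ≠ 0 → c i ≠ 0 ∧ v i ∉ W) ∧ m + 2 ≤ (Function.support c').ncard ∧
        {i | c i ≠ 0 ∧ v i ∈ W}.ncard + (Function.support c').ncard ≤ 3 * (m + 1) := by
      intro W hW
      obtain ⟨t, ht, htW⟩ := hplane W hW
      obtain ⟨c', hc', h0', hsub⟩ := hc.exists_hyperplane_residual _ ht htW
      refine ⟨c', hc', h0', hsub, hc'.add_two_le_ncard_support hv h0', le_trans ?_ hcard⟩
      rw [← Set.ncard_union_eq _ (Set.toFinite _) (Set.toFinite _)]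
      · refine Set.ncard_le_ncard ?_ (Set.toFinite _)
        rintro x (hx | hx)
        exacts [hx.1, (hsub x hx).1]
      · rw [Set.disjoint_left]
        exact fun x hx hx' => (hsub x hx').2 hx.2
    obtain ⟨L, hL, hLm⟩ : ∃ L : Submodule k (σ → k), finrank k L ≤ 2 ∧
        m + 2 ≤ {i | c i ≠ 0 ∧ v i ∈ L}.ncard := by
      obtain ⟨i, j, t, hi, hj, ht, hij, hit, hjt⟩ := (Set.two_lt_ncard_iff (Set.toFinite _)).mp
        (show 2 < (Function.support c).ncard by
          have := hc.add_two_le_ncard_support hv h0; omega)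
      have hW : finrank k (Submodule.span k ({v i, v j, v t} : Set (σ → k))) ≤ 3 := by
        have := finrank_span_finset_le_card (R := k) ({v i, v j, v t} : Finset (σ → k))
        simp only [Finset.coe_insert, Finset.coe_singleton] at this
        exact this.trans Finset.card_le_three
      obtain ⟨c', hc', h0', hsub, hge, hle⟩ := hcut _ hW
      have h3 : 3 ≤ {x | c x ≠ 0 ∧
          v x ∈ Submodule.span k ({v i, v j, v t} : Set (σ → k))}.ncard := by
        rw [← Set.ncard_eq_three.mpr ⟨i, j, t, hij, hit, hjt, rfl⟩]
        refine Set.ncard_le_ncard ?_ (Set.toFinite _)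
        rintro x (rfl | rfl | rfl)
        · exact ⟨hi, Submodule.subset_span (by simp)⟩
        · exact ⟨hj, Submodule.subset_span (by simp)⟩
        · exact ⟨ht, Submodule.subset_span (by simp)⟩
      have hmono : ∀ L : Submodule k (σ → k), {x | c' x ≠ 0 ∧ v x ∈ L}.ncard ≤
          {x | c x ≠ 0 ∧ v x ∈ L}.ncard := fun L =>
        Set.ncard_le_ncard (fun x hx => ⟨(hsub x hx.1).1, hx.2⟩) (Set.toFinite _)
      rcases ih hc' h0' (by omega) with ⟨L, hL, hLm⟩ | ⟨W, hW, hWc⟩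
      · exact ⟨L, hL, hLm.trans (hmono L)⟩
      · have hall : ∀ L : Submodule k (σ → k), (∀ x, c' x ≠ 0 → v x ∈ L) →
            (Function.support c').ncard ≤ {x | c x ≠ 0 ∧ v x ∈ L}.ncard := fun L hL =>
          Set.ncard_le_ncard (fun x hx => ⟨(hsub x hx).1, hL x hx⟩) (Set.toFinite _)
        obtain ⟨_, _, _, _, hge', hle'⟩ := hcut W hW
        have := hall W hWc
        obtain ⟨L, hL, hLc⟩ := hc'.exists_line hv h0' (by omega)
        exact ⟨L, hL, hge.trans (hall L hLc)⟩
    -- a plane through `L` and one more point leaves a residual set on another line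
    have hres : ∀ q, c q ≠ 0 → v q ∉ L → ∃ (L' : Submodule k (σ → k)) (c' : ι → k),
        finrank k L' ≤ 2 ∧ m + 2 ≤ (Function.support c').ncard ∧ c' q = 0 ∧
        ∀ i, c' i ≠ 0 → c i ≠ 0 ∧ v i ∉ L ∧ v i ∈ L' := by
      intro q hq hqL
      have hW : finrank k (L ⊔ Submodule.span k {v q} : Submodule k (σ → k)) ≤ 3 := by
        have h1 := Submodule.finrank_add_le_finrank_add_finrank L (Submodule.span k {v q})
        have h2 := finrank_span_singleton (K := k) (hv.1 q)
        omega
      obtain ⟨c', hc', h0', hsub, hge, hle⟩ := hcut _ hW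
      have hqW : v q ∈ L ⊔ Submodule.span k {v q} :=
        Submodule.mem_sup_right (Submodule.mem_span_singleton_self _)
      have h1 : {i | c i ≠ 0 ∧ v i ∈ L}.ncard + 1 ≤
          {i | c i ≠ 0 ∧ v i ∈ L ⊔ Submodule.span k {v q}}.ncard := by
        refine Set.ncard_lt_ncard ⟨fun i hi => ⟨hi.1, Submodule.mem_sup_left hi.2⟩, fun hs => ?_⟩
          (Set.toFinite _)
        exact hqL (hs ⟨hq, hqW⟩ : _ ∧ _).2
      obtain ⟨L', hL', hLc'⟩ := hc'.exists_line hv h0' (by omega)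
      refine ⟨L', c', hL', hge, ?_, fun i hi =>
        ⟨(hsub i hi).1, fun hiL => (hsub i hi).2 (Submodule.mem_sup_left hiL), hLc' i hi⟩⟩
      by_contra hne
      exact (hsub q hne).2 hqW
    obtain ⟨q, hq, hqL⟩ := hplane L (by omega)
    obtain ⟨L₁, c₁, hL₁, hge₁, -, hc₁⟩ := hres q hq hqL
    obtain ⟨p, hp⟩ : (Function.support c₁).Nonempty := by
      rw [← Set.ncard_pos (Set.toFinite _)]; omega
    obtain ⟨L₂, c₂, hL₂, hge₂, hp₂, hc₂⟩ := hres p (hc₁ p hp).1 (hc₁ p hp).2.1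
    -- the two residual sets share two points, so that the two lines agree
    have hunion : {i | c i ≠ 0 ∧ v i ∈ L}.ncard +
        (Function.support c₁ ∪ Function.support c₂).ncard ≤ 3 * (m + 1) := by
      refine le_trans ?_ hcard
      rw [← Set.ncard_union_eq _ (Set.toFinite _) (Set.toFinite _)]
      · refine Set.ncard_le_ncard ?_ (Set.toFinite _)
        rintro x (hx | hx | hx)
        exacts [hx.1, (hc₁ x hx).1, (hc₂ x hx).1]
      · rw [Set.disjoint_left]
        rintro x hx (hx' | hx')
        exacts [(hc₁ x hx').2.1 hx.2, (hc₂ x hx').2.1 hx.2]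
    have hinter := Set.ncard_union_add_ncard_inter (Function.support c₁) (Function.support c₂)
      (Set.toFinite _) (Set.toFinite _)
    obtain ⟨i, j, hi, hj, hij⟩ := (Set.one_lt_ncard_iff (Set.toFinite _)).mp
      (show 1 < (Function.support c₁ ∩ Function.support c₂).ncard by omega)
    have hLL : L₁ = L₂ := by
      rw [hv.eq_span_pair hij hL₁ (hc₁ i hi.1).2.2 (hc₁ j hj.1).2.2,
        hv.eq_span_pair hij hL₂ (hc₂ i hi.2).2.2 (hc₂ j hj.2).2.2]
    have hlt := hline L₁ hL₁
    have : (Function.support c₂).ncard < {i | c i ≠ 0 ∧ v i ∈ L₁}.ncard := by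
      refine Set.ncard_lt_ncard ⟨fun x hx => ⟨(hc₂ x hx).1, hLL ▸ (hc₂ x hx).2.2⟩, fun hs => ?_⟩
        (Set.toFinite _)
      exact hs ⟨(hc₁ p hp).1, (hc₁ p hp).2.2⟩ hp₂
    omega

end Space

/-! ### Linked points -/

section Points

variable {k : Type*} [Field k] {N n : ℕ}

lemma isProjectivelyDistinct_rep {ι : Type*} {P : ι → ℙ k (Fin (N + 1) → k)}
    (hP : Function.Injective P) : IsProjectivelyDistinct fun i => (P i).rep := by
  refine ⟨fun i => (P i).rep_nonzero, fun i j hij h => hij (hP ?_)⟩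
  obtain ⟨a, ha⟩ := Submodule.mem_span_singleton.mp h
  rw [← (P i).mk_rep, ← (P j).mk_rep, Projectivization.mk_eq_mk_iff']
  exact ⟨a, ha⟩

lemma MvPolynomial.IsHomogeneous.eval_smul {σ : Type*} {m : ℕ} {f : MvPolynomial σ k}
    (hf : f.IsHomogeneous m) (a : k) (x : σ → k) : eval (a • x) f = a ^ m * eval x f := by
  rw [eval_eq, eval_eq, Finset.mul_sum]
  refine Finset.sum_congr rfl fun d hd => ?_
  have hd' : ∑ i ∈ d.support, d i = m := (hf.degree_eq_sum_deg_support hd).symm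
  simp only [Pi.smul_apply, smul_eq_mul, mul_pow, Finset.prod_mul_distrib,
    Finset.prod_pow_eq_pow_sum, hd']
  ring

/-- Rescaling the vectors rescales the relations. -/
lemma IsRelation.smul {σ ι : Type*} [Fintype ι] {m : ℕ} {v w : ι → σ → k} {c : ι → k}
    (hc : IsRelation m w c) (a : ι → k) (ha : ∀ i, w i = a i • v i) :
    IsRelation m v fun i => c i * a i ^ m := by
  intro f hf
  rw [← hc f hf]
  refine Finset.sum_congr rfl fun i _ => ?_
  rw [ha, MvPolynomial.IsHomogeneous.eval_smul hf, mul_assoc]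

lemma isLinked_iff {ι : Type*} [Fintype ι] (m : ℕ) (P : ι → ℙ k (Fin (N + 1) → k)) :
    IsLinked m P ↔ ∃ c ≠ 0, IsRelation m (fun i => (P i).rep) c := by
  have hlead : ∀ i, (P i).rep (leadIndex (P i)) ^ m ≠ 0 := by
    intro i
    refine pow_ne_zero _ ?_
    unfold leadIndex
    have h : ∀ (s : Finset (Fin (N + 1))) (hs : s.Nonempty), (∀ j ∈ s, (P i).rep j ≠ 0) →
        (P i).rep (s.min' hs) ≠ 0 := fun s hs h => h _ (s.min'_mem hs)
    exact h _ _ fun j hj => by simpa using hj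
  set a : ι → k := fun i => ((P i).rep (leadIndex (P i)) ^ m)⁻¹ with ha
  have ha0 : ∀ i, a i ≠ 0 := fun i => inv_ne_zero (hlead i)
  have hev : ∀ i f, evForm m (P i) f = a i * eval (P i).rep (f : MvPolynomial _ k) := by
    intro i f
    simp [evForm, aeval_eq_eval, ha]
  rw [IsLinked, IsGeneralPosition, Fintype.not_linearIndependent_iff]
  constructor
  · rintro ⟨g, hg, i, hi⟩
    refine ⟨fun i => g i * a i, Function.ne_iff.mpr ⟨i, mul_ne_zero hi (ha0 i)⟩, fun f hf => ?_⟩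
    have := LinearMap.congr_fun hg ⟨f, hf⟩
    simpa [LinearMap.sum_apply, hev, mul_assoc] using this
  · rintro ⟨c, hc0, hc⟩
    obtain ⟨i, hi⟩ := Function.ne_iff.mp hc0
    refine ⟨fun i => c i * (a i)⁻¹, ?_, i, mul_ne_zero hi (inv_ne_zero (ha0 i))⟩
    ext f
    simpa [LinearMap.sum_apply, hev, mul_assoc, ha0] using hc f f.2

/-- A bound on the smallest number of linked points yields a relation involving no more points.
-/
lemma exists_relation_of_minLinked_le {m s : ℕ} {P : Fin n → ℙ k (Fin (N + 1) → k)}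
    (h : minLinked m P ≤ s) :
    ∃ c ≠ 0, IsRelation m (fun i => (P i).rep) c ∧ (Function.support c).ncard ≤ s := by
  classical
  have hlt : minLinked m P < (s : ℕ∞) + 1 := by
    refine lt_of_le_of_lt h ?_
    exact_mod_cast Nat.lt_succ_self s
  simp only [minLinked, iInf_lt_iff] at hlt
  obtain ⟨S, hS, hcard⟩ := hlt
  obtain ⟨c, hc0, hc⟩ := (isLinked_iff m _).mp hS
  refine ⟨fun i => if h : i ∈ S then c ⟨i, h⟩ else 0, ?_, fun f hf => ?_, ?_⟩
  · obtain ⟨i, hi⟩ := Function.ne_iff.mp hc0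
    exact Function.ne_iff.mpr ⟨i, by simpa using hi⟩
  · refine Eq.trans ?_ (hc f hf)
    rw [← Finset.sum_subset (Finset.subset_univ S), ← Finset.sum_coe_sort S]
    · exact Finset.sum_congr rfl fun i _ => by simp
    · intro i _ hi
      simp only [dif_neg hi, zero_mul]
  · have hsub : (Function.support fun i => if h : i ∈ S then c ⟨i, h⟩ else 0) ⊆
        (S : Set (Fin n)) := by
      intro i hi
      by_contra h
      exact hi (dif_neg h)
    have h1 := Set.ncard_le_ncard hsub (Set.toFinite _)
    rw [Set.ncard_coe_finset] at h1
    have h2 : S.card < s + 1 := by exact_mod_cast hcard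
    omega

/-- Points of a linear subspace on which the forms of degree `m` of the subspace have too few
values are linked. -/
lemma minLinked_le_card {m r : ℕ} {P : Fin n → ℙ k (Fin (N + 1) → k)} {S : Finset (Fin n)}
    (φ : (Fin r → k) →ₗ[k] (Fin (N + 1) → k)) (w : S → Fin r → k)
    (hw : ∀ i : S, ∃ hv : φ (w i) ≠ 0, P i = Projectivization.mk k (φ (w i)) hv)
    (hrank : finrank k (LinearMap.range (evalMap m w)) < S.card) :
    minLinked m P ≤ S.card := by
  rw [← Fintype.card_coe S] at hrank
  obtain ⟨c, hc0, hc⟩ := finrank_range_evalMap_lt_iff.mp hrank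
  refine iInf₂_le S ((isLinked_iff m _).mpr ?_)
  have hex : ∀ i : S, ∃ a : kˣ, φ (w i) = (a : k) • (P i).rep := by
    intro i
    obtain ⟨hv, h⟩ := hw i
    obtain ⟨a, ha⟩ := Projectivization.exists_smul_eq_mk_rep k (φ (w i)) hv
    refine ⟨a⁻¹, ?_⟩
    rw [h, ← ha, ← Units.smul_def, inv_smul_smul]
  choose a ha using hex
  refine ⟨_, ?_, (hc.comp φ).smul (fun i => (a i : k)) ha⟩
  obtain ⟨i, hi⟩ := Function.ne_iff.mp hc0
  exact Function.ne_iff.mpr ⟨i, mul_ne_zero hi (pow_ne_zero _ (a i).ne_zero)⟩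

lemma minLinked_le_of_hasCollinear {m : ℕ} {P : Fin n → ℙ k (Fin (N + 1) → k)}
    (h : HasCollinear (m + 2) P) : minLinked m P ≤ (m + 2 : ℕ) := by
  obtain ⟨S, hS, L, hL, hPL⟩ := h
  let e : L ≃ₗ[k] (Fin 2 → k) := LinearEquiv.ofFinrankEq _ _ (by simp [hL])
  have hmem : ∀ i : S, (P i).rep ∈ L := fun i => hPL i i.2 (by
    rw [Projectivization.submodule_eq]; exact Submodule.mem_span_singleton_self _)
  rw [← hS]
  refine minLinked_le_card (L.subtype ∘ₗ e.symm.toLinearMap) (fun i => e ⟨_, hmem i⟩)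
    (fun i => ⟨by simpa using (P i).rep_nonzero, by simp⟩) ?_
  have h1 := LinearMap.finrank_range_le (evalMap m fun i : S => e ⟨_, hmem i⟩)
  rw [finrank_homogeneousSubmodule, show 2 + m - 1 = m + 1 by omega,
    Nat.choose_succ_self_right] at h1
  omega

lemma minLinked_le_of_hasOnConic {m : ℕ} (hm : 2 ≤ m) {P : Fin n → ℙ k (Fin (N + 1) → k)}
    (h : HasOnConic (2 * m + 2) P) : minLinked m P ≤ (2 * m + 2 : ℕ) := by
  obtain ⟨S, hS, φ, hφ, F, ⟨hF0, hF⟩, hPF⟩ := h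
  choose w hw hPw hFw using fun i : S => hPF i i.2
  rw [← hS]
  refine minLinked_le_card φ w (fun i => ⟨hw i, hPw i⟩) ?_
  obtain ⟨b, rfl⟩ := Nat.exists_eq_add_of_le hm
  have := two_mul_finrank_range_evalMap_le (d := 2 + b) hF hF0 rfl hFw
  nlinarith

lemma minLinked_le_of_hasOnIntersection {m : ℕ} (hm : 3 ≤ m)
    {P : Fin n → ℙ k (Fin (N + 1) → k)} (h : HasOnIntersection (3 * m) 3 m P) :
    minLinked m P ≤ (3 * m : ℕ) := by
  obtain ⟨S, hS, φ, hφ, F, G, ⟨hF0, hF⟩, ⟨hG0, hG⟩, hrel, hPFG⟩ := h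
  have hv : ∀ i : S, ∃ w : Fin 3 → k, (∃ hw : φ w ≠ 0, P i = Projectivization.mk k (φ w) hw) ∧
      eval w F = 0 ∧ eval w G = 0 := by
    intro i
    obtain ⟨⟨w, hw, hPw, hFw⟩, w', hw', hPw', hGw'⟩ := hPFG i i.2
    refine ⟨w, ⟨hw, hPw⟩, hFw, ?_⟩
    rw [hPw, Projectivization.mk_eq_mk_iff'] at hPw'
    obtain ⟨a, ha⟩ := hPw'
    obtain rfl : a • w' = w := hφ (by rw [map_smul, ha])
    rw [MvPolynomial.IsHomogeneous.eval_smul hG, hGw', mul_zero]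
  choose w hw hFw hGw using hv
  rw [← hS]
  refine minLinked_le_card φ w hw ?_
  obtain ⟨b, rfl⟩ := Nat.exists_eq_add_of_le hm
  have hFG : ¬ F ∣ G := by
    intro hd
    obtain ⟨i⟩ : Nonempty S := by
      rw [← Fintype.card_pos_iff, Fintype.card_coe]; omega
    have := (hrel dvd_rfl hd).map (eval (w i))
    rw [hFw] at this
    exact not_isUnit_zero this
  have := two_mul_finrank_range_evalMap_lt (d := 3 + b) hF hF0 rfl hFw hG hGw hFG
  nlinarith

lemma hasOnConic_of_hasOnIntersection_two {d : ℕ} {P : Fin n → ℙ k (Fin (N + 1) → k)}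
    (h : HasOnIntersection d 3 2 P) : HasOnConic d P := by
  obtain ⟨S, hS, φ, hφ, F, G, -, hG, -, hPFG⟩ := h
  exact ⟨S, hS, φ, hφ, G, hG, fun i hi => (hPFG i hi).2⟩

lemma hasCollinear_of_finrank_le {d : ℕ} (hd : 2 ≤ d) {P : Fin n → ℙ k (Fin (N + 1) → k)}
    (hP : Function.Injective P) {L : Submodule k (Fin (N + 1) → k)} (hL : finrank k L ≤ 2)
    {T : Set (Fin n)} (hT : d ≤ T.ncard) (hTL : ∀ i ∈ T, (P i).rep ∈ L) : HasCollinear d P := by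
  classical
  obtain ⟨U, hUT, hU⟩ := Set.exists_subset_card_eq hT
  refine ⟨U.toFinset, by rw [← hU, Set.ncard_eq_toFinset_card'], L, ?_, fun i hi => ?_⟩
  · obtain ⟨i, j, hi, hj, hij⟩ := (Set.one_lt_ncard_iff (Set.toFinite _)).mp
      (show 1 < T.ncard by omega)
    rw [(isProjectivelyDistinct_rep hP).eq_span_pair hij hL (hTL i hi) (hTL j hj)]
    exact (isProjectivelyDistinct_rep hP).finrank_span_pair hij
  · rw [Projectivization.submodule_eq, Submodule.span_singleton_le_iff_mem]
    exact hTL i (hUT (by simpa using hi))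

/-- Every form of degree `1` comes from a functional. -/
lemma exists_eq_linearForm {σ : Type*} [Fintype σ] [DecidableEq σ] {E : MvPolynomial σ k}
    (hE : E.IsHomogeneous 1) : ∃ l : (σ → k) →ₗ[k] k, E = linearForm l := by
  have hE' : E ∈ homogeneousSubmodule σ k 1 := hE
  rw [homogeneousSubmodule_one_eq_span_X] at hE'
  clear hE
  induction hE' using Submodule.span_induction with
  | mem x hx =>
    obtain ⟨s, rfl⟩ := hx
    exact ⟨LinearMap.proj s, by simp [linearForm, Pi.single_apply]⟩
  | zero => exact ⟨0, by simp [linearForm]⟩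
  | add x y hx hy hx' hy' =>
    obtain ⟨l, rfl⟩ := hx'
    obtain ⟨l', rfl⟩ := hy'
    exact ⟨l + l', by simp [linearForm, add_mul, Finset.sum_add_distrib]⟩
  | smul a x hx hx' =>
    obtain ⟨l, rfl⟩ := hx'
    exact ⟨a • l, by simp [linearForm, Finset.smul_sum, smul_eq_C_mul, mul_assoc]⟩

/-- At most `3 m` points supporting a relation of degree `m`
contain `m + 2` collinear points or `2 m + 2` points of a plane conic, or are the `3 m` points
common to a plane cubic and a plane curve of degree `m`. -/
theorem IsRelation.classification {m : ℕ} (hm : 2 ≤ m) {P : Fin n → ℙ k (Fin (N + 1) → k)}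
    (hP : Function.Injective P) {c : Fin n → k} (hc : IsRelation m (fun i => (P i).rep) c)
    (h0 : c ≠ 0) (hcard : (Function.support c).ncard ≤ 3 * m) :
    HasCollinear (m + 2) P ∨
    (HasOnConic (2 * m + 2) P ∧ 2 * m + 2 ≤ (Function.support c).ncard) ∨
    (3 ≤ m ∧ HasOnIntersection (3 * m) 3 m P ∧ (Function.support c).ncard = 3 * m) := by
  classical
  have hv := isProjectivelyDistinct_rep hP
  have hge := hc.add_two_le_ncard_support hv h0
  rcases hc.exists_line_or_plane hv h0 hcard with ⟨L, hL, hLm⟩ | ⟨W, hW, hWc⟩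
  · exact Or.inl (hasCollinear_of_finrank_le (by omega) hP hL hLm fun i hi => hi.2)
  have hline : ∀ L : Submodule k (Fin (N + 1) → k), finrank k L ≤ 2 →
      (∀ i, c i ≠ 0 → (P i).rep ∈ L) → HasCollinear (m + 2) P := fun L hL hLc =>
    hasCollinear_of_finrank_le (by omega) hP hL hge fun i hi => hLc i hi
  rcases Nat.lt_or_ge (finrank k W) 3 with hW3 | hW3
  · exact Or.inl (hline W (by omega) hWc)
  -- coordinates on the plane
  let ε : W ≃ₗ[k] (Fin 3 → k) := LinearEquiv.ofFinrankEq _ _ (by simp; omega)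
  let φ : (Fin 3 → k) →ₗ[k] (Fin (N + 1) → k) := W.subtype ∘ₗ ε.symm.toLinearMap
  have hφ : Function.Injective φ := W.injective_subtype.comp ε.symm.injective
  obtain ⟨ψ, hψ⟩ := φ.exists_leftInverse_of_injective (LinearMap.ker_eq_bot.mpr hφ)
  have hψ' : ∀ x, ψ (φ x) = x := fun x => LinearMap.congr_fun hψ x
  have hφψ : ∀ i, c i ≠ 0 → φ (ψ (P i).rep) = (P i).rep := by
    intro i hi
    have : φ (ε ⟨_, hWc i hi⟩) = (P i).rep := by simp [φ]
    rw [← this, hψ']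
  let w : {i // c i ≠ 0} → Fin 3 → k := fun i => ψ (P i).rep
  have hw : IsProjectivelyDistinct w := by
    refine ⟨fun i hi => hv.1 i ?_, fun i j hij h => hv.2 i j (fun h => hij (Subtype.ext h)) ?_⟩
    · exact (hφψ i i.2).symm.trans ((congrArg φ hi).trans (map_zero φ))
    · have := Submodule.mem_map_of_mem (f := φ) h
      rw [Submodule.map_span, Set.image_singleton] at this
      simpa [w, hφψ i i.2, hφψ j j.2] using this
  have hcw : IsRelation m w fun i => c i := (hc.comp ψ).restrict fun i hi => hi
  have : Nonempty {i // c i ≠ 0} := by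
    obtain ⟨i, hi⟩ := Function.ne_iff.mp h0
    exact ⟨⟨i, hi⟩⟩
  have hcw' : Fintype.card {i // c i ≠ 0} = (Function.support c).ncard := by
    rw [← Nat.card_coe_set_eq, ← Nat.card_eq_fintype_card]
    rfl
  have hlies : ∀ F : MvPolynomial (Fin 3) k, (∀ i, eval (w i) F = 0) →
      ∀ i, c i ≠ 0 → LiesOnCurve φ F (P i) := by
    intro F hF i hi
    refine ⟨w ⟨i, hi⟩, ?_, ?_, hF _⟩
    · rw [show φ (w ⟨i, hi⟩) = (P i).rep from hφψ i hi]
      exact (P i).rep_nonzero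
    · simp [w, hφψ i hi]
  rcases hcw.plane_classification hw (fun i => i.2) (hcw' ▸ hcard) with
    ⟨E, hE0, hE, hEw⟩ | ⟨hge', E, hE0, hE, hEw⟩ |
    ⟨hm3, hcard', E, G, hE0, hG0, hE, hG, hrel, hEw, hGw⟩
  · left
    obtain ⟨l, rfl⟩ := exists_eq_linearForm hE
    have hl : l ≠ 0 := by
      rintro rfl
      simp [linearForm] at hE0
    refine hline ((LinearMap.ker l).map φ) ?_ fun i hi => ⟨w ⟨i, hi⟩, ?_, hφψ i hi⟩
    · refine (Submodule.finrank_map_le _ _).trans ?_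
      have h1 : finrank k (LinearMap.ker l) < finrank k (Fin 3 → k) :=
        Submodule.finrank_lt fun h => hl (LinearMap.ker_eq_top.mp h)
      rw [Module.finrank_fintype_fun_eq_card, Fintype.card_fin] at h1
      omega
    · simpa using hEw ⟨i, hi⟩
  · rw [hcw'] at hge'
    obtain ⟨U, hUT, hU⟩ := Set.exists_subset_card_eq hge'
    refine Or.inr (Or.inl ⟨⟨U.toFinset, by rw [← hU, Set.ncard_eq_toFinset_card'], φ, hφ, E,
      ⟨hE0, hE⟩, fun i hi => hlies E hEw i (hUT (by simpa using hi))⟩, hge'⟩)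
  · rw [hcw'] at hcard'
    refine Or.inr (Or.inr ⟨hm3, ⟨(Function.support c).toFinset, ?_, φ, hφ, E, G, ⟨hE0, hE⟩,
      ⟨hG0, hG⟩, hrel, fun i hi => ?_⟩, hcard'⟩)
    · rw [← hcard', Set.ncard_eq_toFinset_card']
    · have hi' : c i ≠ 0 := by simpa using hi
      exact ⟨hlies E hEw i hi', hlies G hGw i hi'⟩

end Points

end

theorem theorem3p8 {k : Type*} [Field k] {N n : ℕ} (m : ℕ) (hm : 2 ≤ m)
    (P : Fin n → ℙ k (Fin (N + 1) → k)) (hP : Function.Injective P) :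
    (minLinked m P = ((m + 2 : ℕ) : ℕ∞) ↔ HasCollinear (m + 2) P) ∧
    (minLinked m P = ((2 * m + 2 : ℕ) : ℕ∞) ↔
      ¬ HasCollinear (m + 2) P ∧ HasOnConic (2 * m + 2) P) ∧
    ((3 ≤ m ∧ minLinked m P = ((3 * m : ℕ) : ℕ∞)) ↔
      ¬ HasCollinear (m + 2) P ∧ ¬ HasOnConic (2 * m + 2) P ∧
        HasOnIntersection (3 * m) 3 m P) ∧
    (((3 * m : ℕ) : ℕ∞) < minLinked m P ↔
      ¬ HasCollinear (m + 2) P ∧ ¬ HasOnConic (2 * m + 2) P ∧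
        ¬ HasOnIntersection (3 * m) 3 m P) := by
  have hcol := minLinked_le_of_hasCollinear (m := m) (P := P)
  have hcon := minLinked_le_of_hasOnConic hm (P := P)
  have hint := fun h3 : 3 ≤ m => minLinked_le_of_hasOnIntersection h3 (P := P)
  have htwo : m = 2 → HasOnIntersection (3 * m) 3 m P → HasOnConic (2 * m + 2) P := by
    rintro rfl h
    exact hasOnConic_of_hasOnIntersection_two h
  have hmin : ∀ s : ℕ, minLinked m P = s → m + 2 ≤ s := by
    intro s hs
    obtain ⟨c, h0, hc, hcs⟩ := exists_relation_of_minLinked_le hs.le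
    exact (hc.add_two_le_ncard_support (isProjectivelyDistinct_rep hP) h0).trans hcs
  have hclass : ∀ s : ℕ, minLinked m P = s → s ≤ 3 * m → HasCollinear (m + 2) P ∨
      (HasOnConic (2 * m + 2) P ∧ 2 * m + 2 ≤ s) ∨
      (3 ≤ m ∧ HasOnIntersection (3 * m) 3 m P ∧ 3 * m ≤ s) := by
    intro s hs hs3
    obtain ⟨c, h0, hc, hcs⟩ := exists_relation_of_minLinked_le hs.le
    rcases hc.classification hm hP h0 (hcs.trans hs3) with h | ⟨h, h'⟩ | ⟨h, h', h''⟩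
    · exact Or.inl h
    · exact Or.inr (Or.inl ⟨h, h'.trans hcs⟩)
    · exact Or.inr (Or.inr ⟨h, h', h'' ▸ hcs⟩)
  generalize minLinked m P = μ at *
  induction μ using ENat.recTopCoe with
  | top =>
    have h1 : ¬ HasCollinear (m + 2) P := fun h => (ENat.natCast_lt_top _).not_ge (hcol h)
    have h2 : ¬ HasOnConic (2 * m + 2) P := fun h => (ENat.natCast_lt_top _).not_ge (hcon h)
    have h3 : ¬ HasOnIntersection (3 * m) 3 m P := fun h => by
      rcases hm.eq_or_lt with h' | h'
      · exact h2 (htwo h'.symm h)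
      · exact (ENat.natCast_lt_top _).not_ge (hint h' h)
    refine ⟨⟨fun h => absurd h (ENat.top_ne_natCast _), fun h => absurd h h1⟩,
      ⟨fun h => absurd h (ENat.top_ne_natCast _), fun h => absurd h.2 h2⟩,
      ⟨fun h => absurd h.2 (ENat.top_ne_natCast _), fun h => absurd h.2.2 h3⟩,
      fun _ => ⟨h1, h2, h3⟩, fun _ => ENat.natCast_lt_top _⟩
  | coe s =>
    have hmin := hmin s rfl
    have hclass := hclass s rfl
    simp only [Nat.cast_inj, Nat.cast_le, Nat.cast_lt] at hcol hcon hint ⊢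
    by_cases h1 : HasCollinear (m + 2) P <;> by_cases h2 : HasOnConic (2 * m + 2) P <;>
      by_cases h3 : HasOnIntersection (3 * m) 3 m P <;>
      simp only [h1, h2, h3, forall_const, true_and, false_and, and_true, and_false, true_or,
        false_or, or_false, not_true_eq_false, not_false_eq_true, iff_true, iff_false, imp_false,
        IsEmpty.forall_iff] at * <;> omega
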